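/- Let $H$ and $U$ be real Hilbert spaces, let $A : D(A)\subset H\to H$ be the generator of a strongly continuous semigroup of contractions on $H$, let $B : U\to H$ be a bounded linear operator with adjoint $B^\star$, and let $k>0$. For a linear operator $L$ put $\|z\|_{D(L)}=\|z\|_H+\|Lz\|_H$ for $z\in D(L)$. Let $\sigma : U\to U$ satisfy: 1. $\sigma$ is locally Lipschitz and maps bounded sets to bounded sets (both hold if $\sigma$ is Lipschitz on bounded sets); 2. $\langle \sigma(s_1)-\sigma(s_2),s_1-s_2\rangle_U\ge 0$ for all $s_1,s_2\in U$; 3. there are constants $C_1,C_2>0$ and a continuous non-decreasing function $h:\mathbb R\to[0,\infty)$ with $h(0)>0$ such that $\|\sigma(s)-C_1s\|_U\le C_2\,h(\|s\|_U)\,\langle\sigma(s),s\rangle_U$ for all $s\in U$. Assume that the linear closed loop $z'=\tilde A z$, $\tilde A=A-kBB^\star$, $D(\tilde A)=D(A)$, is $1$-globally polynomially stable with some $\gamma>\frac12$: there is $C>0$ with $$\|e^{t\tilde A}z_0\|_H\le \frac{C}{(1+t)^{\gamma}}\|z_0\|_{D(\tilde A)}\qquad\text{for all } z_0\in D(A),\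 t\ge 0.$$ Consider the nonlinear closed loop $$z'=A_\sigma(z),\qquad A_\sigma(z)=Az-\sqrt k\,B\,\sigma(\sqrt k\,B^\star z),\qquad D(A_\sigma)=D(A).$$ A strong solution is a function $z:[0,\infty)\to H$ that is locally absolutely continuous, takes values in $D(A)$, and satisfies the equation for almost every $t>0$. Then for every $z_0\in D(A)$ there is exactly one strong solution $t\mapsto W_\sigma(t)z_0$ with initial value $z_0$, and the origin is semi-globally polynomially stable in $D(A)$ with rate $\frac12$: for every $r>0$ there is a constant $C(r)>0$ such that, for all $z_0\in D(A)$ with $\|z_0\|_{D(A)}\le r$, $$\|W_\sigma(t)z_0\|_H\le\frac{C(r)}{(1+t)^{1/2}}\,\|z_0\|_{D(A)}\qquad\text{for all } t\ge 0.$$ -/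

import Mathlib

open Filter Topology MeasureTheory

noncomputable section

namespace NonlinearDamping

variable {H U : Type*} [NormedAddCommGroup H] [InnerProductSpace ℝ H] [CompleteSpace H]
  [NormedAddCommGroup U] [InnerProductSpace ℝ U] [CompleteSpace U]

/-- `T` restricted to `[0, ∞)` is a strongly continuous semigroup of contractions on `H`
(the values at negative times play no role). -/
structure IsContractionSemigroup (T : ℝ → H →L[ℝ] H) : Prop where
  zero : T 0 = ContinuousLinearMap.id ℝ H
  add : ∀ s t : ℝ, 0 ≤ s → 0 ≤ t → T (s + t) = (T s).comp (T t)
  continuous_zero : ∀ x : H, Tendsto (fun t => T t x) (𝓝[>] 0) (𝓝 x)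
  contraction : ∀ t : ℝ, 0 ≤ t → ∀ x : H, ‖T t x‖ ≤ ‖x‖

/-- `L` is the infinitesimal generator of `T`: `x` lies in the domain of `L` exactly when
`(T h x - x) / h` converges as `h ↓ 0`, and then the limit is `L x`. -/
def IsGenerator (L : H →ₗ.[ℝ] H) (T : ℝ → H →L[ℝ] H) : Prop :=
  ∀ x y : H, (x, y) ∈ L.graph ↔
    Tendsto (fun h : ℝ => h⁻¹ • (T h x - x)) (𝓝[>] 0) (𝓝 y)

/-- `L` generates a strongly continuous semigroup of contractions. -/
def GeneratesContractionSemigroup (L : H →ₗ.[ℝ] H) : Prop :=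
  ∃ T : ℝ → H →L[ℝ] H, IsContractionSemigroup T ∧ IsGenerator L T

/-- The graph norm `‖z‖ + ‖L z‖` on the domain of `L`. -/
def graphNorm (L : H →ₗ.[ℝ] H) (z : L.domain) : ℝ :=
  ‖(z : H)‖ + ‖L z‖

/-- The origin of `z' = L z` is `1`-globally polynomially stable with exponent `γ`:
`‖e^{tL} z₀‖ ≤ C (1 + t)^{-γ} ‖z₀‖_{D(L)}` for all `z₀ ∈ D(L)` and `t ≥ 0`. Here `e^{tL}` is the
contraction semigroup generated by `L`; it is determined by `L` on `[0, ∞)`, so that quantifying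
over all `T` generated by `L` just names it. The notion is meant for generators `L`. -/
def IsPolynomiallyStable (L : H →ₗ.[ℝ] H) (γ : ℝ) : Prop :=
  0 < γ ∧ ∃ C : ℝ, 0 < C ∧
    ∀ T : ℝ → H →L[ℝ] H, IsContractionSemigroup T → IsGenerator L T →
      ∀ z₀ : L.domain, ∀ t : ℝ, 0 ≤ t →
        ‖T t z₀‖ ≤ C / (1 + t) ^ γ * graphNorm L z₀

/-- The linear closed-loop operator `A - k B B⋆`, with domain `D(A)`. -/
def linearClosedLoop (A : H →ₗ.[ℝ] H) (B : U →L[ℝ] H) (k : ℝ) : H →ₗ.[ℝ] H where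
  domain := A.domain
  toFun := A.toFun -
    (k • (B.comp (ContinuousLinearMap.adjoint B)) : H →L[ℝ] H).toLinearMap.comp A.domain.subtype

/-- The nonlinear closed-loop operator `A_σ z = A z - √k B σ(√k B⋆ z)`, with domain `D(A)`. -/
def nonlinearClosedLoop (A : H →ₗ.[ℝ] H) (B : U →L[ℝ] H) (k : ℝ) (σ : U → U)
    (z : A.domain) : H :=
  A z - √k • B (σ (√k • ContinuousLinearMap.adjoint B z))

/-- Nonlinear damping functions on `U`, in the case `S = U` (so that `S' = U' = U`). -/
structure IsNonlinearDamping (σ : U → U) : Prop where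
  locallyLipschitz : LocallyLipschitz σ
  /-- Together with the previous item this is implied by Lipschitz continuity on bounded sets;
  it is automatic if `U` is finite-dimensional. -/
  bounded : ∀ s : Set U, Bornology.IsBounded s → Bornology.IsBounded (σ '' s)
  monotone : ∀ s₁ s₂ : U, 0 ≤ inner ℝ (σ s₁ - σ s₂) (s₁ - s₂)
  linear_bound : ∃ C₁ C₂ : ℝ, 0 < C₁ ∧ 0 < C₂ ∧ ∃ h : ℝ → ℝ,
    Continuous h ∧ Monotone h ∧ (∀ x, 0 ≤ h x) ∧ 0 < h 0 ∧
      ∀ s : U, ‖σ s - C₁ • s‖ ≤ C₂ * h ‖s‖ * inner ℝ (σ s) s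

/-- `z` is a strong solution on `[0, ∞)` of `z' = F z`, `z 0 = z₀`, where `F : D → H`: it is locally
absolutely continuous, stays in `D`, and satisfies the equation at almost every `t > 0`. -/
structure IsStrongSolution {D : Submodule ℝ H} (F : D → H) (z₀ : D) (z : ℝ → H) : Prop where
  init : z 0 = z₀
  absolutelyContinuous : ∀ T : ℝ, 0 < T → AbsolutelyContinuousOnInterval z 0 T
  mem : ∀ t : ℝ, 0 ≤ t → z t ∈ D
  eqn : ∀ᵐ t : ℝ, ∀ ht : 0 < t, HasDerivAt z (F ⟨z t, mem t ht.le⟩) t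

/-- `W` is the flow of `z' = F z`: for every `z₀ ∈ D`, `t ↦ W t z₀` is the unique strong solution
on `[0, ∞)` starting at `z₀`. -/
def IsStrongFlow {D : Submodule ℝ H} (F : D → H) (W : ℝ → D → H) : Prop :=
  ∀ z₀ : D, IsStrongSolution F z₀ (fun t => W t z₀) ∧
    ∀ w : ℝ → H, IsStrongSolution F z₀ w → ∀ t : ℝ, 0 ≤ t → w t = W t z₀

/-- The origin is semi-globally polynomially stable in `D(A)` with exponent `γ` for the flow `W`. -/
def IsSemiGloballyPolynomiallyStable (A : H →ₗ.[ℝ] H) (W : ℝ → A.domain → H) (γ : ℝ) : Prop :=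
  0 < γ ∧ ∀ r : ℝ, 0 < r → ∃ C : ℝ, 0 < C ∧
    ∀ z₀ : A.domain, graphNorm A z₀ ≤ r → ∀ t : ℝ, 0 ≤ t →
      ‖W t z₀‖ ≤ C / (1 + t) ^ γ * graphNorm A z₀

end NonlinearDamping

end

/-!
The nonlinear flow is contractive and so is its time derivative, so that the graph norm of the
solution `z` stays bounded by a multiple of its initial value. Restarting the linear closed loop
from `z t`, the difference of the two flows after time `τ` is at most a constant times the energy
`‖z t‖² - ‖z (t + τ)‖²` dissipated by the nonlinear flow, because on bounded sets the power
`⟨σ s, s⟩` controls `‖s - σ s‖²`. Hence `E = ‖z‖²` satisfies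
`E (t + τ) ≤ q E t + M (1 + τ)^{-2γ}` with some `q < 1`, and comparing the times `1 + t` and
`l (1 + t)`, for a ratio `l < 1` close to `1`, yields `E t = O((1 + t)^{-2γ})`.
-/

noncomputable section

namespace NonlinearDamping

open Set
open scoped NNReal

section Analysis

variable {E F : Type*} [NormedAddCommGroup E] [NormedAddCommGroup F]

theorem exists_ultrafilter_tendsto_inner {𝕜 X ι : Type*} [RCLike 𝕜] [NormedAddCommGroup X]
    [InnerProductSpace 𝕜 X] [CompleteSpace X] {l : Filter ι} [l.NeBot] {v : ι → X} {M : ℝ}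
    (hv : ∀ᶠ i in l, ‖v i‖ ≤ M) :
    ∃ 𝒰 : Ultrafilter ι, 𝒰 ≤ l ∧ ∃ w : X, ‖w‖ ≤ M ∧
      ∀ y, Tendsto (fun i => inner 𝕜 (v i) y) 𝒰 (𝓝 (inner 𝕜 w y)) := by
  let 𝒰 := Ultrafilter.of l
  let φ : ι → WeakDual 𝕜 X := fun i =>
    StrongDual.toWeakDual (InnerProductSpace.toDual 𝕜 X (v i))
  have hφ : ∀ᶠ i in (𝒰 : Filter ι),
      φ i ∈ WeakDual.toStrongDual ⁻¹' Metric.closedBall (0 : StrongDual 𝕜 X) M := by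
    filter_upwards [Ultrafilter.of_le l hv] with i hi
    rw [mem_preimage, mem_closedBall_zero_iff]
    exact ((InnerProductSpace.toDual 𝕜 X).norm_map _).trans_le hi
  obtain ⟨ψ, hψ, hlim⟩ :=
    (WeakDual.isCompact_closedBall (0 : StrongDual 𝕜 X) M).ultrafilter_le_nhds' (𝒰.map φ) hφ
  rw [mem_preimage, mem_closedBall_zero_iff] at hψ
  refine ⟨𝒰, Ultrafilter.of_le l,
    (InnerProductSpace.toDual 𝕜 X).symm (WeakDual.toStrongDual ψ), by simpa using hψ, fun y => ?_⟩
  rw [InnerProductSpace.toDual_symm_apply]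
  exact ((WeakDual.eval_continuous y).tendsto ψ).comp hlim

theorem exists_norm_le_mul_of_locallyLipschitz {f : E → F} (hf : LocallyLipschitz f) (h0 : f 0 = 0)
    {R : ℝ} (hb : Bornology.IsBounded (f '' Metric.closedBall 0 R)) :
    ∃ L, 0 ≤ L ∧ ∀ s, ‖s‖ ≤ R → ‖f s‖ ≤ L * ‖s‖ := by
  obtain ⟨M, hM⟩ := hb.exists_norm_le
  obtain ⟨K, V, hV, hK⟩ := hf 0
  obtain ⟨ε, hε, hεV⟩ := Metric.mem_nhds_iff.1 hV
  refine ⟨max K (M / ε), le_max_of_le_left K.2, fun s hs => ?_⟩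
  rcases lt_or_ge ‖s‖ ε with hlt | hge
  · have hLip := hK.norm_sub_le (hεV (mem_ball_zero_iff.2 hlt)) (hεV (Metric.mem_ball_self hε))
    rw [h0, sub_zero, sub_zero] at hLip
    exact hLip.trans (by gcongr; exact le_max_left _ _)
  · have hfM : ‖f s‖ ≤ M := hM _ (mem_image_of_mem f (mem_closedBall_zero_iff.2 hs))
    calc ‖f s‖ ≤ M / ε * ε := by rwa [div_mul_cancel₀ _ hε.ne']
      _ ≤ M / ε * ‖s‖ := by
        have : 0 ≤ M := (norm_nonneg _).trans hfM
        gcongr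
      _ ≤ max (K : ℝ) (M / ε) * ‖s‖ := by gcongr; exact le_max_right _ _

theorem absolutelyContinuousOnInterval_norm {f : ℝ → E} {a b : ℝ}
    (hf : AbsolutelyContinuousOnInterval f a b) :
    AbsolutelyContinuousOnInterval (fun t => ‖f t‖) a b := by
  refine squeeze_zero (fun _ => Finset.sum_nonneg fun _ _ => dist_nonneg) (fun t => ?_) hf
  exact Finset.sum_le_sum fun _ _ => (dist_norm_norm_le _ _).trans_eq (dist_eq_norm _ _).symm

variable [NormedSpace ℝ E]

theorem hasDerivWithinAt_Ioi_iff_tendsto {f : ℝ → E} {f' : E} {t : ℝ} :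
    HasDerivWithinAt f f' (Ioi t) t ↔
      Tendsto (fun h : ℝ => h⁻¹ • (f (t + h) - f t)) (𝓝[>] 0) (𝓝 f') := by
  rw [hasDerivWithinAt_iff_tendsto_slope' self_notMem_Ioi,
    show 𝓝[>] t = map (t + ·) (𝓝[>] 0) by simp, tendsto_map'_iff]
  simp [slope, Function.comp_def]

variable [CompleteSpace E]

theorem tendsto_inv_smul_integral {φ : ℝ → ℝ → E} (hφ : Continuous (Function.uncurry φ)) :
    Tendsto (fun h : ℝ => h⁻¹ • ∫ s in (0 : ℝ)..h, φ h s) (𝓝[≠] 0) (𝓝 (φ 0 0)) := by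
  have hcont : Continuous fun h => ∫ s in (0 : ℝ)..1, φ h (h * s) :=
    intervalIntegral.continuous_parametric_intervalIntegral_of_continuous'
      (f := fun h s => φ h (h * s))
      (hφ.comp (by fun_prop : Continuous fun p : ℝ × ℝ => (p.1, p.1 * p.2))) 0 1
  have hlim := (hcont.tendsto 0).mono_left (nhdsWithin_le_nhds (s := {0}ᶜ))
  simp only [zero_mul, intervalIntegral.integral_const, sub_zero, one_smul] at hlim
  refine hlim.congr' ?_
  filter_upwards [self_mem_nhdsWithin] with h hh
  rw [eq_inv_smul_iff₀ hh, intervalIntegral.smul_integral_comp_mul_left, mul_zero, mul_one]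

theorem ae_hasDerivAt_of_hasDerivWithinAt_Ioi {f g : ℝ → E} {a C : ℝ} (hf : ContinuousOn f (Ici a))
    (hfg : ∀ t, a ≤ t → HasDerivWithinAt f (g t) (Ioi t) t) (hg : ∀ t, a ≤ t → ‖g t‖ ≤ C) :
    ∀ᵐ t : ℝ, a < t → HasDerivAt f (g t) t := by
  have hcomp : Continuous fun t => f (max t a) :=
    hf.comp_continuous (by fun_prop) fun t => le_max_right t a
  have hmeas : StronglyMeasurable fun t => g (max t a) := by
    refine stronglyMeasurable_of_tendsto (𝓝[>] (0 : ℝ))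
      (f := fun h t => h⁻¹ • (f (max t a + max h 0) - f (max t a))) (fun h => ?_) ?_
    · have : Continuous fun t => f (max t a + max h 0) :=
        hf.comp_continuous (by fun_prop) fun t => le_add_of_le_of_nonneg (le_max_right t a)
          (le_max_right h 0)
      exact ((this.sub hcomp).const_smul _).stronglyMeasurable
    · refine tendsto_pi_nhds.2 fun t => ?_
      refine (hasDerivWithinAt_Ioi_iff_tendsto.1 (hfg _ (le_max_right t a))).congr' ?_
      filter_upwards [self_mem_nhdsWithin] with h hh
      rw [max_eq_left (mem_Ioi.1 hh).le]
  have hint : LocallyIntegrable (fun t => g (max t a)) volume :=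
    (locallyIntegrable_const C).mono hmeas.aestronglyMeasurable
      (.of_forall fun t => (hg _ (le_max_right t a)).trans (le_abs_self C))
  have hFTC : ∀ t, a ≤ t → ∫ s in a..t, g (max s a) = f t - f a := fun t hat =>
    intervalIntegral.integral_eq_sub_of_hasDeriv_right_of_le hat (hf.mono Icc_subset_Ici_self)
      (fun s hs => by simpa only [max_eq_left hs.1.le] using hfg s hs.1.le)
      (hint.integrableOn_isCompact isCompact_uIcc).intervalIntegrable
  filter_upwards [_root_.LocallyIntegrable.ae_hasDerivAt_integral hint] with t hderiv hat
  have hd := (hderiv a).add_const (f a)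
  rw [max_eq_left hat.le] at hd
  refine hd.congr_of_eventuallyEq ?_
  filter_upwards [eventually_gt_nhds hat] with s hs
  rw [hFTC s hs.le, sub_add_cancel]

end Analysis

section Decay

theorem forall_one_le_of_mul {Q : ℝ → Prop} {l : ℝ} (hl0 : 0 < l) (hl1 : l < 1)
    (hshort : ∀ x, 1 ≤ x → l * x ≤ 1 → Q x) (hstep : ∀ x, 1 ≤ l * x → Q (l * x) → Q x) :
    ∀ x, 1 ≤ x → Q x := by
  have hpow : ∀ n : ℕ, ∀ x, 1 ≤ x → l ^ n * x ≤ 1 → Q x := by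
    intro n
    induction n with
    | zero => exact fun x h1 hx => hshort x h1 (by nlinarith)
    | succ n ih =>
      intro x h1 hx
      rcases le_total (l * x) 1 with h | h
      · exact hshort x h1 h
      · exact hstep x h (ih (l * x) h (by rwa [← mul_assoc, ← pow_succ]))
  intro x hx
  obtain ⟨n, hn⟩ := exists_pow_lt_of_lt_one (by positivity : 0 < x⁻¹) hl1
  refine hpow n x hx ?_
  rw [← le_div_iff₀ (by positivity), one_div]
  exact hn.le

theorem le_mul_div_rpow_of_le_mul_add {E : ℝ → ℝ} {q p l K M : ℝ} (hq : 0 ≤ q) (hp : 0 ≤ p)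
    (hl0 : 0 < l) (hl1 : l < 1) (hM : 0 ≤ M) (hK : (l ^ p)⁻¹ ≤ K)
    (hfix : q / l ^ p * K + ((1 - l) ^ p)⁻¹ ≤ K) (hE : ∀ t, 0 ≤ t → E t ≤ M)
    (hrec : ∀ t τ, 0 ≤ t → 0 ≤ τ → E (t + τ) ≤ q * E t + M / (1 + τ) ^ p) {t : ℝ} (ht : 0 ≤ t) :
    E t ≤ K * M / (1 + t) ^ p := by
  suffices h : ∀ x, 1 ≤ x → E (x - 1) ≤ K * M / x ^ p by simpa using h (1 + t) (by linarith)
  have hlp : 0 < l ^ p := Real.rpow_pos_of_pos hl0 p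
  refine forall_one_le_of_mul hl0 hl1 (fun x hx hlx => ?_) fun x hlx ih => ?_
  · have hxp : 0 < x ^ p := Real.rpow_pos_of_pos (by linarith) p
    have hlxp : l ^ p * x ^ p ≤ 1 := by
      rw [← Real.mul_rpow hl0.le (by linarith)]
      exact Real.rpow_le_one (by positivity) hlx hp
    calc E (x - 1) ≤ M := hE _ (by linarith)
      _ ≤ (l ^ p)⁻¹ * M / x ^ p := by
        rw [le_div_iff₀ hxp, le_inv_mul_iff₀ hlp]
        nlinarith
      _ ≤ K * M / x ^ p := by gcongr
  · have hx0 : 0 < x := pos_of_mul_pos_right (by linarith) hl0.le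
    have hxp : 0 < x ^ p := Real.rpow_pos_of_pos hx0 p
    have : 0 < (1 - l) ^ p := Real.rpow_pos_of_pos (by linarith) p
    have hsplit := hrec (l * x - 1) ((1 - l) * x) (by linarith) (by nlinarith)
    rw [show l * x - 1 + (1 - l) * x = x - 1 by ring] at hsplit
    have htail : M / (1 + (1 - l) * x) ^ p ≤ M / ((1 - l) ^ p * x ^ p) := by
      rw [← Real.mul_rpow (by linarith) hx0.le]
      have : 0 < (1 - l) * x := mul_pos (by linarith) hx0
      gcongr
      linarith
    rw [Real.mul_rpow hl0.le hx0.le] at ih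
    calc E (x - 1) ≤ q * (K * M / (l ^ p * x ^ p)) + M / ((1 - l) ^ p * x ^ p) :=
          hsplit.trans (by gcongr)
      _ = (q / l ^ p * K + ((1 - l) ^ p)⁻¹) * M / x ^ p := by field_simp
      _ ≤ K * M / x ^ p := by gcongr

theorem exists_forall_le_mul_div_rpow {q p : ℝ} (hq0 : 0 ≤ q) (hq1 : q < 1) (hp : 0 < p) :
    ∃ K, 0 < K ∧ ∀ (E : ℝ → ℝ) (M : ℝ), 0 ≤ M → (∀ t, 0 ≤ t → E t ≤ M) →
      (∀ t τ, 0 ≤ t → 0 ≤ τ → E (t + τ) ≤ q * E t + M / (1 + τ) ^ p) →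
      ∀ t, 0 ≤ t → E t ≤ K * M / (1 + t) ^ p := by
  obtain ⟨l, hl0, hl1, hql⟩ : ∃ l : ℝ, 0 < l ∧ l < 1 ∧ q < l ^ p := by
    refine ⟨((1 + q) / 2) ^ p⁻¹, by positivity,
      Real.rpow_lt_one (by linarith) (by linarith) (inv_pos.2 hp), ?_⟩
    rw [Real.rpow_inv_rpow (by linarith) hp.ne']
    linarith
  have hlp : 0 < l ^ p := Real.rpow_pos_of_pos hl0 p
  have : 0 < (1 - l) ^ p := Real.rpow_pos_of_pos (by linarith) p
  have hqlp : 0 < 1 - q / l ^ p := by rwa [sub_pos, div_lt_one hlp]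
  let K₁ := ((1 - l) ^ p)⁻¹ / (1 - q / l ^ p)
  have hK₁ : 0 < K₁ := by positivity
  have hK₁eq : K₁ * (1 - q / l ^ p) = ((1 - l) ^ p)⁻¹ := div_mul_cancel₀ _ hqlp.ne'
  refine ⟨(l ^ p)⁻¹ + K₁, by positivity, fun E M hM hE hrec t ht =>
    le_mul_div_rpow_of_le_mul_add hq0 hp.le hl0 hl1 hM (by linarith) ?_ hE hrec ht⟩
  have : 0 < (l ^ p)⁻¹ * (1 - q / l ^ p) := by positivity
  linarith

end Decay

section Semigroup

variable {H : Type*} [NormedAddCommGroup H] [InnerProductSpace ℝ H] {T : ℝ → H →L[ℝ] H}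

/-- A contraction semigroup that is moreover jointly continuous in time and space on all of
`ℝ × H`. The requirement at negative times costs nothing: every contraction semigroup can be
extended to negative times by the identity. -/
structure IsContinuousContractionSemigroup (S : ℝ → H →L[ℝ] H) : Prop
    extends IsContractionSemigroup S where
  continuous_uncurry : Continuous fun p : ℝ × H => S p.1 p.2

theorem IsContractionSemigroup.norm_sub_le (hT : IsContractionSemigroup T) (x : H) {s t : ℝ}
    (hs : 0 ≤ s) (ht : 0 ≤ t) : ‖T t x - T s x‖ ≤ ‖T |t - s| x - x‖ := by
  wlog hst : s ≤ t generalizing s t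
  · rw [norm_sub_rev, abs_sub_comm]
    exact this ht hs (le_of_not_ge hst)
  rw [abs_of_nonneg (sub_nonneg.2 hst)]
  calc ‖T t x - T s x‖ = ‖T s (T (t - s) x - x)‖ := by
        rw [map_sub, ← ContinuousLinearMap.comp_apply, ← hT.add s (t - s) hs (sub_nonneg.2 hst),
          add_sub_cancel]
    _ ≤ ‖T (t - s) x - x‖ := hT.contraction s hs _

theorem IsContractionSemigroup.continuous_max_zero (hT : IsContractionSemigroup T) (x : H) :
    Continuous fun t => T (max t 0) x := by
  have hzero : Tendsto (fun h => ‖T h x - x‖) (𝓝[≥] 0) (𝓝 0) := by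
    have h : ContinuousWithinAt (fun h => T h x) (Ioi 0) 0 := by
      simpa [ContinuousWithinAt, hT.zero] using hT.continuous_zero x
    rw [continuousWithinAt_Ioi_iff_Ici, ContinuousWithinAt, hT.zero] at h
    exact tendsto_iff_norm_sub_tendsto_zero.1 h
  refine continuous_iff_continuousAt.2 fun t => tendsto_iff_norm_sub_tendsto_zero.2 ?_
  have hdist : Tendsto (fun s => |max s 0 - max t 0|) (𝓝 t) (𝓝[≥] 0) := by
    refine tendsto_nhdsWithin_iff.2 ⟨?_, .of_forall fun s => mem_Ici.2 (abs_nonneg _)⟩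
    have : Continuous fun s => |max s 0 - max t 0| := by fun_prop
    simpa using this.tendsto t
  exact squeeze_zero (fun s => norm_nonneg _)
    (fun s => hT.norm_sub_le x (le_max_right _ _) (le_max_right _ _)) (hzero.comp hdist)

theorem IsContractionSemigroup.isContinuous_max_zero (hT : IsContractionSemigroup T) :
    IsContinuousContractionSemigroup fun t => T (max t 0) where
  zero := by rw [max_self, hT.zero]
  add s t hs ht := by
    rw [max_eq_left (add_nonneg hs ht), max_eq_left hs, max_eq_left ht, hT.add s t hs ht]
  continuous_zero x := by
    simpa [hT.zero] using
      ((hT.continuous_max_zero x).tendsto 0).mono_left (nhdsWithin_le_nhds (s := Ioi 0))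
  contraction t _ := hT.contraction _ (le_max_right t 0)
  continuous_uncurry := by
    have hnorm : ∀ t : ℝ, ‖T (max t 0)‖ ≤ 1 := fun t =>
      ContinuousLinearMap.opNorm_le_bound _ zero_le_one fun x => by
        simpa using hT.contraction _ (le_max_right t 0) x
    exact continuous_prod_of_continuous_lipschitzWith' _ 1
      (fun t => (T (max t 0)).lipschitz.weaken (hnorm t)) hT.continuous_max_zero

theorem GeneratesContractionSemigroup.exists_continuous {L : H →ₗ.[ℝ] H}
    (hL : GeneratesContractionSemigroup L) :
    ∃ S : ℝ → H →L[ℝ] H, IsContinuousContractionSemigroup S ∧ IsGenerator L S := by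
  obtain ⟨T, hT, hLT⟩ := hL
  refine ⟨_, hT.isContinuous_max_zero, fun x y => (hLT x y).trans (tendsto_congr' ?_)⟩
  filter_upwards [self_mem_nhdsWithin] with t ht
  rw [max_eq_left (mem_Ioi.1 ht).le]

variable {S : ℝ → H →L[ℝ] H}

theorem IsContinuousContractionSemigroup.continuous_orbit
    (hS : IsContinuousContractionSemigroup S) (x : H) : Continuous fun t => S t x :=
  hS.continuous_uncurry.comp (by fun_prop : Continuous fun t : ℝ => (t, x))

end Semigroup

section MildSolution

/-- The mild solution `u t = S t x + ∫₀ᵗ S (t - s) (f s) ds` of `u' = A u + f`, `u 0 = x`, where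
`A` generates `S` (Duhamel's formula). -/
def mildSol {E : Type*} [NormedAddCommGroup E] [NormedSpace ℝ E] (S : ℝ → E →L[ℝ] E) (x : E)
    (f : ℝ → E) (t : ℝ) : E :=
  S t x + ∫ s in (0 : ℝ)..t, S (t - s) (f s)

section NormedSpace

variable {E : Type*} [NormedAddCommGroup E] [NormedSpace ℝ E] {S : ℝ → E →L[ℝ] E} {f g : ℝ → E}

theorem continuous_apply_sub (hc : Continuous fun p : ℝ × E => S p.1 p.2) (hf : Continuous f) :
    Continuous (Function.uncurry fun t s : ℝ => S (t - s) (f s)) :=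
  hc.comp (by fun_prop : Continuous fun p : ℝ × ℝ => (p.1 - p.2, f p.2))

theorem intervalIntegrable_apply_sub (hc : Continuous fun p : ℝ × E => S p.1 p.2)
    (hf : Continuous f) (t a b : ℝ) :
    IntervalIntegrable (fun s => S (t - s) (f s)) volume a b :=
  ((continuous_apply_sub hc hf).comp (Continuous.prodMk_right t)).intervalIntegrable a b

theorem continuous_mildSol (hc : Continuous fun p : ℝ × E => S p.1 p.2) (x : E)
    (hf : Continuous f) : Continuous (mildSol S x f) := by
  have horbit : Continuous fun t => S t x :=
    hc.comp (by fun_prop : Continuous fun t : ℝ => (t, x))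
  exact horbit.add (intervalIntegral.continuous_parametric_intervalIntegral_of_continuous
    (continuous_apply_sub hc hf) continuous_id)

theorem mildSol_congr (x : E) {t : ℝ} (ht : 0 ≤ t) (h : EqOn f g (Icc 0 t)) :
    mildSol S x f t = mildSol S x g t := by
  refine congrArg (S t x + ·) (intervalIntegral.integral_congr fun s hs => ?_)
  rw [uIcc_of_le ht] at hs
  simp only [h hs]

theorem mildSol_sub (hc : Continuous fun p : ℝ × E => S p.1 p.2) (x y : E) (hf : Continuous f)
    (hg : Continuous g) (t : ℝ) :
    mildSol S x f t - mildSol S y g t = mildSol S (x - y) (fun s => f s - g s) t := by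
  simp only [mildSol, map_sub]
  rw [intervalIntegral.integral_sub (intervalIntegrable_apply_sub hc hf t 0 t)
    (intervalIntegrable_apply_sub hc hg t 0 t)]
  abel

end NormedSpace

variable {H : Type*} [NormedAddCommGroup H] [InnerProductSpace ℝ H] {S : ℝ → H →L[ℝ] H}
  {f : ℝ → H}

theorem IsContractionSemigroup.mildSol_zero (hS : IsContractionSemigroup S) (x : H) (f : ℝ → H) :
    mildSol S x f 0 = x := by
  simp [mildSol, hS.zero]

theorem IsContractionSemigroup.norm_mildSol_sub_le (hS : IsContractionSemigroup S) (x : H)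
    {t M : ℝ} (ht : 0 ≤ t) (hM : ∀ s ∈ Icc 0 t, ‖f s‖ ≤ M) :
    ‖mildSol S x f t - S t x‖ ≤ M * t := by
  rw [mildSol, add_sub_cancel_left]
  calc ‖∫ s in (0 : ℝ)..t, S (t - s) (f s)‖ ≤ M * |t - 0| := by
        refine intervalIntegral.norm_integral_le_of_norm_le_const fun s hs => ?_
        rw [uIoc_of_le ht] at hs
        exact (hS.contraction _ (sub_nonneg.2 hs.2) _).trans (hM s ⟨hs.1.le, hs.2⟩)
    _ = M * t := by rw [sub_zero, abs_of_nonneg ht]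

variable [CompleteSpace H]

theorem IsContinuousContractionSemigroup.mildSol_add (hS : IsContinuousContractionSemigroup S)
    (x : H) (hf : Continuous f) {t h : ℝ} (ht : 0 ≤ t) (hh : 0 ≤ h) :
    mildSol S x f (t + h) = mildSol S (mildSol S x f t) (fun s => f (t + s)) h := by
  have hint := intervalIntegrable_apply_sub hS.continuous_uncurry hf
  have horbit : S (t + h) x = S h (S t x) := by
    rw [add_comm, hS.add h t hh ht, ContinuousLinearMap.comp_apply]
  have hpast : ∫ s in (0 : ℝ)..t, S (t + h - s) (f s) =
      S h (∫ s in (0 : ℝ)..t, S (t - s) (f s)) := by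
    rw [← ContinuousLinearMap.intervalIntegral_comp_comm _ (hint t 0 t)]
    refine intervalIntegral.integral_congr fun s hs => ?_
    rw [uIcc_of_le ht] at hs
    simp only [show t + h - s = h + (t - s) by ring]
    rw [hS.add h (t - s) hh (sub_nonneg.2 hs.2), ContinuousLinearMap.comp_apply]
  have hfuture : ∫ s in t..(t + h), S (t + h - s) (f s) =
      ∫ s in (0 : ℝ)..h, S (h - s) (f (t + s)) := by
    simpa using (intervalIntegral.integral_comp_add_left (a := 0) (b := h)
      (fun s => S (t + h - s) (f s)) t).symm
  rw [mildSol, ← intervalIntegral.integral_add_adjacent_intervals (hint _ 0 t) (hint _ t (t + h)),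
    horbit, hpast, hfuture, mildSol, mildSol, map_add, add_assoc]

theorem IsContinuousContractionSemigroup.tendsto_mildSol_sub
    (hS : IsContinuousContractionSemigroup S) (x : H) (hf : Continuous f) :
    Tendsto (fun h : ℝ => h⁻¹ • (mildSol S x f h - S h x)) (𝓝[>] 0) (𝓝 (f 0)) := by
  simpa [mildSol, hS.zero] using
    (tendsto_inv_smul_integral (continuous_apply_sub hS.continuous_uncurry hf)).mono_left
      (nhdsGT_le_nhdsNE 0)

theorem IsContinuousContractionSemigroup.eventually_norm_mildSol_sq_lt
    (hS : IsContinuousContractionSemigroup S) (x : H) (hf : Continuous f) {r : ℝ}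
    (hr : 2 * inner ℝ (f 0) x < r) :
    ∀ᶠ h in 𝓝[>] (0 : ℝ), h⁻¹ * (‖mildSol S x f h‖ ^ 2 - ‖x‖ ^ 2) < r := by
  have hmild : Tendsto (mildSol S x f) (𝓝[>] 0) (𝓝 x) := by
    simpa [hS.mildSol_zero] using ((continuous_mildSol hS.continuous_uncurry x hf).tendsto
      0).mono_left (nhdsWithin_le_nhds (s := Ioi 0))
  have hlim := (hS.tendsto_mildSol_sub x hf).inner (𝕜 := ℝ) (hmild.add (hS.continuous_zero x))
  rw [← two_smul ℝ x, inner_smul_right] at hlim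
  filter_upwards [hlim.eventually_lt_const hr, self_mem_nhdsWithin] with h hlt hh
  refine lt_of_le_of_lt ?_ hlt
  have hh : 0 < h := hh
  have hdiff : inner ℝ (mildSol S x f h - S h x) (mildSol S x f h + S h x) =
      ‖mildSol S x f h‖ ^ 2 - ‖S h x‖ ^ 2 := by
    rw [inner_add_right, inner_sub_left, inner_sub_left, real_inner_self_eq_norm_sq,
      real_inner_self_eq_norm_sq, real_inner_comm]
    ring
  rw [real_inner_smul_left, hdiff]
  gcongr
  exact hS.contraction h hh.le x

theorem IsContinuousContractionSemigroup.norm_sq_le_of_eqOn_mildSol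
    (hS : IsContinuousContractionSemigroup S) (x : H) (hf : Continuous f) {u : ℝ → H}
    (hu : Continuous u) {t : ℝ} (ht : 0 ≤ t) (huf : EqOn u (mildSol S x f) (Icc 0 t)) :
    ‖u t‖ ^ 2 ≤ ‖x‖ ^ 2 + ∫ s in (0 : ℝ)..t, 2 * inner ℝ (f s) (u s) := by
  have hpower : Continuous fun s => 2 * inner ℝ (f s) (u s) := by fun_prop
  refine image_le_of_liminf_slope_right_le_deriv_boundary (f := fun t => ‖u t‖ ^ 2)
    (B := fun t => ‖x‖ ^ 2 + ∫ s in (0 : ℝ)..t, 2 * inner ℝ (f s) (u s))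
    (a := 0) (by fun_prop) ?_
    (continuous_const.add (intervalIntegral.continuous_primitive
      (fun a b => hpower.intervalIntegrable a b) 0)).continuousOn
    (fun s _ =>
      ((hpower.integral_hasStrictDerivAt 0 s).hasDerivAt.const_add _).hasDerivWithinAt)
    (fun s hs r hr => Eventually.frequently ?_) (right_mem_Icc.2 ht)
  · simp [huf (left_mem_Icc.2 ht), hS.mildSol_zero]
  · rw [show 𝓝[>] s = map (s + ·) (𝓝[>] 0) by simp, eventually_map]
    have hlocal := hS.eventually_norm_mildSol_sq_lt (u s)
      (f := fun h => f (s + h)) (by fun_prop) (by simpa using hr)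
    filter_upwards [hlocal, Ioo_mem_nhdsGT (sub_pos.2 hs.2)] with h hlt hh
    rwa [slope_def_field, add_sub_cancel_left, div_eq_inv_mul,
      huf ⟨add_nonneg hs.1 hh.1.le, by linarith [hh.2]⟩, hS.mildSol_add x hf hs.1 hh.1.le,
      ← huf (Ico_subset_Icc_self hs)]

end MildSolution

section SemilinearEquation

variable {H : Type*} [NormedAddCommGroup H] [InnerProductSpace ℝ H] {S : ℝ → H →L[ℝ] H}
  {F : H → H} {x y : H} {a : ℝ} {z w : ℝ → H}

/-- Dissipativity of an everywhere defined map, which makes the flow of `z' = F z` contractive. -/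
def IsDissipative (F : H → H) : Prop :=
  ∀ a b : H, inner ℝ (F a - F b) (a - b) ≤ 0

/-- `z` is a mild solution on `[0, a]` of `z' = A z + F z`, `z 0 = x`, where `A` generates `S`.
For convenience `z` is a continuous function on the whole line. -/
structure IsMildOn (S : ℝ → H →L[ℝ] H) (F : H → H) (x : H) (a : ℝ) (z : ℝ → H) : Prop where
  continuous : Continuous z
  eqOn : EqOn z (mildSol S x fun s => F (z s)) (Icc 0 a)

/-- A mild solution of `z' = A z + F z`, `z 0 = x` on `[0, ∞)`, where `A` generates `S`. -/
def IsMildSolution (S : ℝ → H →L[ℝ] H) (F : H → H) (x : H) (z : ℝ → H) : Prop :=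
  ∀ a, IsMildOn S F x a z

theorem IsMildOn.mono {b : ℝ} (hz : IsMildOn S F x a z) (hba : b ≤ a) : IsMildOn S F x b z :=
  ⟨hz.continuous, hz.eqOn.mono (Icc_subset_Icc_right hba)⟩

theorem IsMildOn.apply_zero (hz : IsMildOn S F x a z) (hS : IsContractionSemigroup S)
    (ha : 0 ≤ a) : z 0 = x := by
  rw [hz.eqOn (left_mem_Icc.2 ha), hS.mildSol_zero]

variable [CompleteSpace H]

theorem IsMildOn.shift (hz : IsMildOn S F x a z) (hS : IsContinuousContractionSemigroup S)
    (hF : Continuous F) {t h : ℝ} (ht : 0 ≤ t) (hh : 0 ≤ h) (hth : t + h ≤ a) :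
    IsMildOn S F (z t) h fun s => z (t + s) := by
  refine ⟨hz.continuous.comp (continuous_const_add t), fun s hs => ?_⟩
  simp only [hz.eqOn ⟨add_nonneg ht hs.1, (add_le_add_right hs.2 t).trans hth⟩]
  rw [hS.mildSol_add x (hF.comp' hz.continuous) ht hs.1,
    ← hz.eqOn ⟨ht, (le_add_of_nonneg_right hh).trans hth⟩]

theorem IsMildOn.exists_glue (hz : IsMildOn S F x a z) {b : ℝ} (hw : IsMildOn S F (z a) b w)
    (hS : IsContinuousContractionSemigroup S) (hF : Continuous F) (ha : 0 ≤ a) (hb : 0 ≤ b) :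
    ∃ v, IsMildOn S F x (a + b) v := by
  let v : ℝ → H := fun t => if t ≤ a then z t else w (t - a)
  have hw0 : w 0 = z a := hw.apply_zero hS.toIsContractionSemigroup hb
  have hvz : EqOn v z (Iic a) := fun t ht => if_pos ht
  have hvw : ∀ s, 0 ≤ s → v (a + s) = w s := by
    intro s hs
    rcases hs.eq_or_lt with rfl | hs
    · rw [add_zero, hvz self_mem_Iic, hw0]
    · simp [v, hs]
  have hv : Continuous v := by
    refine hz.continuous.if_le (hw.continuous.comp (continuous_sub_right a)) continuous_id
      continuous_const fun t ht => ?_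
    simp [ht, hw0]
  have hleft : EqOn v (mildSol S x fun s => F (v s)) (Icc 0 a) := fun t ht => by
    rw [hvz ht.2, hz.eqOn ht]
    exact mildSol_congr x ht.1 fun s hs => by simp only [hvz (hs.2.trans ht.2)]
  refine ⟨v, hv, fun t ht => ?_⟩
  rcases le_total t a with hta | hat
  · exact hleft ⟨ht.1, hta⟩
  · obtain ⟨s, hs, rfl⟩ : ∃ s, 0 ≤ s ∧ t = a + s := ⟨t - a, by linarith, by ring⟩
    rw [hS.mildSol_add x (hF.comp' hv) ha hs, ← hleft (right_mem_Icc.2 ha), hvw s hs,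
      hw.eqOn ⟨hs, by linarith [ht.2]⟩, hvz self_mem_Iic]
    exact mildSol_congr _ hs fun r hr => by simp only [hvw r hr.1]

theorem IsMildOn.norm_sub_le (hz : IsMildOn S F x a z) (hw : IsMildOn S F y a w)
    (hS : IsContinuousContractionSemigroup S) (hF : Continuous F) (hdiss : IsDissipative F)
    {t : ℝ} (ht : t ∈ Icc 0 a) : ‖z t - w t‖ ≤ ‖x - y‖ := by
  have hFz := hF.comp hz.continuous
  have hFw := hF.comp hw.continuous
  have heq : EqOn (fun s => z s - w s) (mildSol S (x - y) fun s => F (z s) - F (w s))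
      (Icc 0 t) := fun s hs => by
    have hs : s ∈ Icc 0 a := ⟨hs.1, hs.2.trans ht.2⟩
    simp only [hz.eqOn hs, hw.eqOn hs]
    exact mildSol_sub hS.continuous_uncurry x y hFz hFw s
  have henergy : ‖z t - w t‖ ^ 2 ≤
      ‖x - y‖ ^ 2 + ∫ s in (0 : ℝ)..t, 2 * inner ℝ (F (z s) - F (w s)) (z s - w s) :=
    hS.norm_sq_le_of_eqOn_mildSol (x - y) (hFz.sub hFw)
      (hz.continuous.sub hw.continuous) ht.1 heq
  have hdecrease : ∫ s in (0 : ℝ)..t, 2 * inner ℝ (F (z s) - F (w s)) (z s - w s) ≤ 0 := by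
    rw [intervalIntegral.integral_of_le ht.1]
    exact integral_nonpos fun s => mul_nonpos_of_nonneg_of_nonpos zero_le_two (hdiss (z s) (w s))
  exact le_of_sq_le_sq (by linarith) (norm_nonneg _)

theorem IsMildOn.eqOn_of_isDissipative (hz : IsMildOn S F x a z) (hw : IsMildOn S F x a w)
    (hS : IsContinuousContractionSemigroup S) (hF : Continuous F) (hdiss : IsDissipative F) :
    EqOn z w (Icc 0 a) := fun t ht => by
  simpa [sub_eq_zero] using hz.norm_sub_le hw hS hF hdiss ht

theorem IsMildOn.norm_add_sub_le (hz : IsMildOn S F x a z)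
    (hS : IsContinuousContractionSemigroup S) (hF : Continuous F) (hdiss : IsDissipative F)
    {t h : ℝ} (ht : 0 ≤ t) (hh : 0 ≤ h) (hth : t + h ≤ a) : ‖z (t + h) - z t‖ ≤ ‖z h - x‖ := by
  rw [add_comm]
  exact (hz.shift hS hF hh ht (by linarith)).norm_sub_le (hz.mono (by linarith)) hS hF hdiss
    (right_mem_Icc.2 ht)

theorem exists_isMildOn_of_lipschitzOnWith (hS : IsContinuousContractionSemigroup S)
    (hF : Continuous F) {V : Set H} (hV : IsClosed V) {K δ : ℝ≥0} (hK : LipschitzOnWith K F V)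
    (hKδ : K * δ < 1) (hx : x ∈ V)
    (hmaps : ∀ f : ℝ → H, (∀ t, f t ∈ V) →
      ∀ t ∈ Icc (0 : ℝ) δ, mildSol S x (fun s => F (f s)) t ∈ V) :
    ∃ z, IsMildOn S F x δ z := by
  have hext : ∀ f : C(Icc (0 : ℝ) δ, H), Continuous fun s => F (IccExtend δ.coe_nonneg f s) :=
    fun f => hF.comp f.continuous.Icc_extend'
  let picard : C(Icc (0 : ℝ) δ, H) → C(Icc (0 : ℝ) δ, H) := fun f =>
    ⟨fun t => mildSol S x (fun s => F (IccExtend δ.coe_nonneg f s)) t,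
      (continuous_mildSol hS.continuous_uncurry x (hext f)).comp continuous_subtype_val⟩
  let X : Set C(Icc (0 : ℝ) δ, H) := {f | ∀ t, f t ∈ V}
  have hX : IsComplete X := by
    simpa only [X, MapsTo, mem_univ, true_implies] using
      (ContinuousMap.isClosed_setOfPred_mapsTo hV univ).isComplete
  have hpicard : MapsTo picard X X := fun f hf t => hmaps _ (fun s => hf _) t t.2
  have hcontr : ContractingWith (K * δ) (hpicard.restrict picard X X) := by
    refine ⟨hKδ, LipschitzWith.of_dist_le_mul fun f g => ?_⟩
    refine (ContinuousMap.dist_le (by positivity)).2 fun t => ?_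
    have hdiff := hS.norm_mildSol_sub_le 0 (M := K * dist f g)
      (f := fun s => F (IccExtend δ.coe_nonneg f.1 s) - F (IccExtend δ.coe_nonneg g.1 s))
      t.2.1 fun s _ => by
        rw [← dist_eq_norm]
        exact (hK.dist_le_mul _ (f.2 _) _ (g.2 _)).trans
          (by gcongr; exact ContinuousMap.dist_apply_le_dist _)
    rw [map_zero, sub_zero, ← sub_self x,
      ← mildSol_sub hS.continuous_uncurry x x (hext f) (hext g), ← dist_eq_norm] at hdiff
    calc dist (picard f t) (picard g t) ≤ K * dist f g * t := hdiff
      _ ≤ K * dist f g * δ := by gcongr; exact t.2.2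
      _ = ↑(K * δ) * dist f g := by push_cast; ring
  obtain ⟨z, -, hfix, -⟩ := hcontr.exists_fixedPoint' hX hpicard (x := ContinuousMap.const _ x)
    (fun _ => hx) (edist_ne_top _ _)
  refine ⟨IccExtend δ.coe_nonneg z, z.continuous.Icc_extend', fun t ht => ?_⟩
  rw [IccExtend_of_mem _ _ ht]
  exact (DFunLike.congr_fun hfix ⟨t, ht⟩).symm

theorem exists_isMildOn_of_mem_ball (hS : IsContinuousContractionSemigroup S)
    (hF : LocallyLipschitz F) (p : H) :
    ∃ δ > 0, ∃ η > 0, ∀ x ∈ Metric.ball p η, ∃ z, IsMildOn S F x δ z := by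
  obtain ⟨K, V, hV, hK⟩ := hF p
  obtain ⟨ε, hε, hεV⟩ := Metric.nhds_basis_closedBall.mem_iff.1
    (inter_mem hV (hF.continuous.norm.continuousAt.eventually_le_const (lt_add_one ‖F p‖)))
  have hsmall : ∀ᶠ t in 𝓝[≥] (0 : ℝ),
      (‖F p‖ + 1) * t + ‖S t p - p‖ < ε / 2 ∧ (K : ℝ) * t < 1 := by
    have horbit := hS.continuous_orbit p
    refine .and (Tendsto.eventually_lt_const (half_pos hε) ?_)
      (Tendsto.eventually_lt_const one_pos ?_) <;>
    refine tendsto_nhdsWithin_of_tendsto_nhds (Continuous.tendsto' (by fun_prop) _ _ ?_)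
    · simp [hS.zero]
    · simp
  obtain ⟨δ, hδ, hδsmall⟩ := mem_nhdsGE_iff_exists_Icc_subset.1 hsmall
  lift δ to ℝ≥0 using (mem_Ioi.1 hδ).le
  refine ⟨δ, hδ, ε / 2, half_pos hε, fun x hx => ?_⟩
  have hxp : ‖x - p‖ < ε / 2 := mem_ball_iff_norm.1 hx
  refine exists_isMildOn_of_lipschitzOnWith hS hF.continuous Metric.isClosed_closedBall
    (hK.mono (hεV.trans inter_subset_left)) ?_ (Metric.ball_subset_closedBall
      (Metric.ball_subset_ball (half_le_self hε.le) hx)) fun f hf t ht => ?_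
  · exact_mod_cast (hδsmall (right_mem_Icc.2 δ.coe_nonneg)).2
  · have hduhamel := hS.norm_mildSol_sub_le x (f := fun s => F (f s)) ht.1
      fun s _ => (hεV (hf s)).2
    have hcontr := hS.contraction t ht.1 (x - p)
    rw [map_sub] at hcontr
    rw [mem_closedBall_iff_norm]
    linarith [(hδsmall ht).1, norm_sub_le_norm_sub_add_norm_sub
      (mildSol S x (fun s => F (f s)) t) (S t x) p,
      norm_sub_le_norm_sub_add_norm_sub (S t x) (S t p) p]

theorem cauchySeq_apply_of_isMildOn (hS : IsContinuousContractionSemigroup S) (hF : Continuous F)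
    (hdiss : IsDissipative F) {u : ℕ → ℝ} {z : ℕ → ℝ → H} (hu : CauchySeq u) (hu0 : ∀ n, 0 < u n)
    (hz : ∀ n, IsMildOn S F x (u n) (z n)) : CauchySeq fun n => z n (u n) := by
  rw [Metric.cauchySeq_iff]
  intro ε hε
  obtain ⟨δ, hδ, hz0⟩ := Metric.continuous_iff.1 (hz 0).continuous 0 ε hε
  rw [(hz 0).apply_zero hS.toIsContractionSemigroup (hu0 0).le] at hz0
  obtain ⟨N, hN⟩ := Metric.cauchySeq_iff.1 hu (min δ (u 0)) (lt_min hδ (hu0 0))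
  refine ⟨N, fun i hi j hj => ?_⟩
  wlog hij : u i ≤ u j generalizing i j
  · rw [dist_comm]
    exact this j hj i hi (le_of_not_ge hij)
  have hh : 0 ≤ u j - u i := sub_nonneg.2 hij
  have hlt := hN j hj i hi
  rw [Real.dist_eq, abs_of_nonneg hh, lt_min_iff] at hlt
  have hi_eq : z i (u i) = z j (u i) := (hz i).eqOn_of_isDissipative ((hz j).mono hij) hS hF hdiss
    (right_mem_Icc.2 (hu0 i).le)
  have hj_eq : z j (u j - u i) = z 0 (u j - u i) :=
    ((hz j).mono (by linarith [hu0 i])).eqOn_of_isDissipative ((hz 0).mono hlt.2.le) hS hF hdiss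
      (right_mem_Icc.2 hh)
  have hstep := (hz j).norm_add_sub_le hS hF hdiss (hu0 i).le hh (by linarith)
  rw [add_sub_cancel, hj_eq] at hstep
  rw [hi_eq, dist_comm, dist_eq_norm]
  refine hstep.trans_lt ?_
  rw [← dist_eq_norm]
  exact hz0 _ (by rw [Real.dist_eq, sub_zero, abs_of_nonneg hh]; exact hlt.1)

theorem exists_isMildOn (hS : IsContinuousContractionSemigroup S) (hF : LocallyLipschitz F)
    (hdiss : IsDissipative F) (x : H) (a : ℝ) : ∃ z, IsMildOn S F x a z := by
  by_contra hcon
  let J : Set ℝ := {b | ∃ z, IsMildOn S F x b z}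
  have hJmono : ∀ b ∈ J, ∀ c ≤ b, c ∈ J := fun b ⟨z, hz⟩ c hcb => ⟨z, hz.mono hcb⟩
  have hJbdd : BddAbove J := ⟨a, fun b hb => le_of_not_ge fun hab => hcon (hJmono b hb a hab)⟩
  obtain ⟨δ₀, hδ₀, η₀, hη₀, hlocal₀⟩ := exists_isMildOn_of_mem_ball hS hF x
  have hδ₀J : δ₀ ∈ J := hlocal₀ x (Metric.mem_ball_self hη₀)
  have hltJ : ∀ b < sSup J, b ∈ J := fun b hb => by
    obtain ⟨c, hc, hbc⟩ := exists_lt_of_lt_csSup ⟨δ₀, hδ₀J⟩ hb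
    exact hJmono c hc b hbc.le
  obtain ⟨u, -, hu, hu_lim⟩ := exists_seq_strictMono_tendsto' (hδ₀.trans_le (le_csSup hJbdd hδ₀J))
  choose z hz using fun n => hltJ (u n) (hu n).2
  obtain ⟨p, hp⟩ := cauchySeq_tendsto_of_complete
    (cauchySeq_apply_of_isMildOn hS hF.continuous hdiss hu_lim.cauchySeq (fun n => (hu n).1) hz)
  obtain ⟨δ, hδ, η, hη, hlocal⟩ := exists_isMildOn_of_mem_ball hS hF p
  obtain ⟨n, hn_ball, hn_lt⟩ := ((hp.eventually (Metric.ball_mem_nhds p hη)).and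
    (hu_lim.eventually (lt_mem_nhds (sub_lt_self _ hδ)))).exists
  obtain ⟨w, hw⟩ := hlocal _ hn_ball
  have := le_csSup hJbdd ((hz n).exists_glue hw hS hF.continuous (hu n).1.le hδ.le)
  linarith

theorem exists_isMildSolution (hS : IsContinuousContractionSemigroup S) (hF : LocallyLipschitz F)
    (hdiss : IsDissipative F) (x : H) : ∃ z, IsMildSolution S F x z := by
  choose z hz using exists_isMildOn hS hF hdiss x
  let v : ℝ → H := fun t => z (max t 0) (max t 0)
  have hv : ∀ {a t}, max t 0 ≤ a → v t = z a (max t 0) := fun {a t} hta =>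
    (hz _).eqOn_of_isDissipative ((hz a).mono hta) hS hF.continuous hdiss
      (right_mem_Icc.2 (le_max_right t 0))
  have hvc : Continuous v := continuous_iff_continuousAt.2 fun t => by
    have hcont : Continuous fun s => z (max t 0 + 1) (max s 0) :=
      (hz _).continuous.comp (by fun_prop)
    refine hcont.continuousAt.congr ?_
    filter_upwards [eventually_le_nhds (lt_add_one t)] with s hs
    exact (hv (max_le (hs.trans (by gcongr; exact le_max_left t 0)) (by positivity))).symm
  refine ⟨v, fun a => ⟨hvc, fun t ht => ?_⟩⟩
  have hvt : ∀ s ∈ Icc 0 t, v s = z t s := fun s hs => by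
    rw [hv ((max_eq_left hs.1).trans_le hs.2), max_eq_left hs.1]
  rw [hvt t (right_mem_Icc.2 ht.1), (hz t).eqOn (right_mem_Icc.2 ht.1)]
  exact mildSol_congr x ht.1 fun s hs => by simp only [hvt s hs]

end SemilinearEquation

section Regularity

variable {H : Type*} [NormedAddCommGroup H] [InnerProductSpace ℝ H]
  {S : ℝ → H →L[ℝ] H} {A : H →ₗ.[ℝ] H} {F : H → H} {x y : H} {z : ℝ → H} {M : ℝ}

theorem IsGenerator.hasDerivWithinAt (hA : IsGenerator A S) (hS : IsContractionSemigroup S)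
    (hxy : (x, y) ∈ A.graph) {t : ℝ} (ht : 0 ≤ t) :
    HasDerivWithinAt (fun s => S s x) (S t y) (Ioi t) t := by
  rw [hasDerivWithinAt_Ioi_iff_tendsto]
  refine (((S t).continuous.tendsto y).comp ((hA x y).1 hxy)).congr' ?_
  filter_upwards [self_mem_nhdsWithin] with h hh
  simp [hS.add t h ht (mem_Ioi.1 hh).le]

theorem IsGenerator.norm_sub_le (hA : IsGenerator A S) (hS : IsContinuousContractionSemigroup S)
    (hxy : (x, y) ∈ A.graph) {t : ℝ} (ht : 0 ≤ t) : ‖S t x - x‖ ≤ ‖y‖ * t := by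
  simpa [hS.zero] using norm_image_sub_le_of_norm_deriv_right_le_segment (f := fun s => S s x)
    (hS.continuous_orbit x).continuousOn
    (fun s hs => (hA.hasDerivWithinAt hS.toIsContractionSemigroup hxy hs.1).Ici_of_Ioi)
    (fun s hs => hS.contraction s hs.1 y) t (right_mem_Icc.2 ht)

theorem IsGenerator.inner_nonpos (hA : IsGenerator A S) (hS : IsContractionSemigroup S)
    (hxy : (x, y) ∈ A.graph) : inner ℝ y x ≤ 0 := by
  refine le_of_tendsto (((hA x y).1 hxy).inner (𝕜 := ℝ) tendsto_const_nhds) ?_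
  filter_upwards [self_mem_nhdsWithin] with h hh
  have hh : 0 < h := hh
  have hcontr : inner ℝ (S h x) x ≤ ‖x‖ * ‖x‖ :=
    (real_inner_le_norm _ _).trans (by gcongr; exact hS.contraction h hh.le x)
  rw [real_inner_smul_left, inner_sub_left, real_inner_self_eq_norm_mul_norm]
  exact mul_nonpos_of_nonneg_of_nonpos (inv_nonneg.2 hh.le) (sub_nonpos.2 hcontr)

theorem IsMildSolution.continuous (hz : IsMildSolution S F x z) : Continuous z :=
  (hz 0).continuous

theorem IsMildSolution.apply_zero (hz : IsMildSolution S F x z) (hS : IsContractionSemigroup S) :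
    z 0 = x :=
  (hz 0).apply_zero hS le_rfl

theorem IsMildSolution.apply_eq (hz : IsMildSolution S F x z) {t : ℝ} (ht : 0 ≤ t) :
    z t = mildSol S x (fun s => F (z s)) t :=
  (hz t).eqOn (right_mem_Icc.2 ht)

variable [CompleteSpace H]

theorem IsContinuousContractionSemigroup.apply_sub_eq_integral_of_tendsto_inner
    (hS : IsContinuousContractionSemigroup S) {w : H} {l : Filter ℝ} [l.NeBot] (hl : l ≤ 𝓝[>] 0)
    (hw : ∀ y, Tendsto (fun h : ℝ => inner ℝ (h⁻¹ • (S h x - x)) y) l (𝓝 (inner ℝ w y)))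
    {t : ℝ} (ht : 0 ≤ t) : S t x - x = ∫ s in (0 : ℝ)..t, S s w := by
  have hprim : Continuous fun t => ∫ s in (0 : ℝ)..t, S s w :=
    intervalIntegral.continuous_primitive
      (fun a b => (hS.continuous_orbit w).intervalIntegrable a b) 0
  have hle : ∀ y, inner ℝ (S t x) y ≤ inner ℝ (x + ∫ s in (0 : ℝ)..t, S s w) y := by
    intro y
    have horbit := hS.continuous_orbit x
    refine image_le_of_liminf_slope_right_le_deriv_boundary (f := fun t => inner ℝ (S t x) y)
      (B := fun t => inner ℝ (x + ∫ s in (0 : ℝ)..t, S s w) y) (B' := fun s => inner ℝ (S s w) y)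
      (a := 0) (by fun_prop) (by simp [hS.zero]) (by fun_prop)
      (fun s _ => ?_) (fun s hs r hr => ?_) (right_mem_Icc.2 ht)
    · simpa using ((((hS.continuous_orbit w).integral_hasStrictDerivAt 0
        s).hasDerivAt.const_add x).inner ℝ (hasDerivAt_const s y)).hasDerivWithinAt
    · have hslope := hw (ContinuousLinearMap.adjoint (S s) y)
      simp only [ContinuousLinearMap.adjoint_inner_right] at hslope
      rw [show 𝓝[>] s = map (s + ·) (𝓝[>] 0) by simp, frequently_map]
      refine (((hslope.eventually_lt_const hr).frequently.filter_mono hl).and_eventually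
        self_mem_nhdsWithin).mono fun h hh => ?_
      simpa [slope_def_field, hS.add s h hs.1 (mem_Ioi.1 hh.2).le, inner_sub_left,
        real_inner_smul_left, div_eq_inv_mul] using hh.1
  rw [sub_eq_iff_eq_add']
  refine ext_inner_right ℝ fun y => (hle y).antisymm ?_
  simpa only [inner_neg_right, neg_le_neg_iff] using hle (-y)

theorem IsGenerator.exists_mem_graph (hA : IsGenerator A S)
    (hS : IsContinuousContractionSemigroup S) (hx : ∀ h > 0, ‖S h x - x‖ ≤ M * h) :
    ∃ y, (x, y) ∈ A.graph ∧ ‖y‖ ≤ M := by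
  have hquot : ∀ᶠ h : ℝ in 𝓝[>] 0, ‖h⁻¹ • (S h x - x)‖ ≤ M := by
    filter_upwards [self_mem_nhdsWithin] with h hh
    have hh : 0 < h := hh
    rw [norm_smul, norm_inv, Real.norm_of_nonneg hh.le, inv_mul_le_iff₀ hh, mul_comm]
    exact hx h hh
  obtain ⟨𝒰, h𝒰, w, hwM, hw⟩ := exists_ultrafilter_tendsto_inner (𝕜 := ℝ) hquot
  refine ⟨w, (hA x w).2 ?_, hwM⟩
  have hlim := ((hS.continuous_orbit w).integral_hasStrictDerivAt 0
    0).hasDerivAt.tendsto_slope_zero_right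
  simp only [hS.zero, ContinuousLinearMap.id_apply, intervalIntegral.integral_same, zero_add,
    sub_zero] at hlim
  refine hlim.congr' ?_
  filter_upwards [self_mem_nhdsWithin] with h hh
  rw [hS.apply_sub_eq_integral_of_tendsto_inner h𝒰 hw (mem_Ioi.1 hh).le]

theorem IsMildSolution.shift (hz : IsMildSolution S F x z)
    (hS : IsContinuousContractionSemigroup S) (hF : Continuous F) {t : ℝ} (ht : 0 ≤ t) :
    IsMildSolution S F (z t) fun s => z (t + s) := fun a =>
  ((hz _).shift hS hF ht (le_max_right a 0) le_rfl).mono (le_max_left a 0)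

theorem IsMildSolution.norm_sub_le_mul (hz : IsMildSolution S F x z) (hA : IsGenerator A S)
    (hS : IsContinuousContractionSemigroup S) (hF : Continuous F) (hdiss : IsDissipative F)
    (hxy : (x, y) ∈ A.graph) (hM : ∀ t, 0 ≤ t → ‖F (z t)‖ ≤ M) {t h : ℝ} (ht : 0 ≤ t)
    (hh : 0 ≤ h) : ‖z (t + h) - z t‖ ≤ (‖y‖ + M) * h := by
  have hduhamel := hS.norm_mildSol_sub_le x hh fun s hs => hM s hs.1
  rw [← hz.apply_eq hh] at hduhamel
  linarith [(hz _).norm_add_sub_le hS hF hdiss ht hh le_rfl, hA.norm_sub_le hS hxy hh,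
    norm_sub_le_norm_sub_add_norm_sub (z h) (S h x) x]

theorem IsMildSolution.exists_mem_graph (hz : IsMildSolution S F x z) (hA : IsGenerator A S)
    (hS : IsContinuousContractionSemigroup S) (hF : Continuous F) (hdiss : IsDissipative F)
    (hxy : (x, y) ∈ A.graph) (hM : ∀ t, 0 ≤ t → ‖F (z t)‖ ≤ M) {t : ℝ} (ht : 0 ≤ t) :
    ∃ v, (z t, v) ∈ A.graph ∧ ‖v‖ ≤ ‖y‖ + 2 * M := by
  refine hA.exists_mem_graph hS fun h hh => ?_
  have hduhamel := hS.norm_mildSol_sub_le (z t) (f := fun s => F (z (t + s))) hh.le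
    fun s hs => hM (t + s) (add_nonneg ht hs.1)
  rw [← (hz.shift hS hF ht).apply_eq hh.le, norm_sub_rev] at hduhamel
  linarith [hz.norm_sub_le_mul hA hS hF hdiss hxy hM ht hh.le,
    norm_sub_le_norm_sub_add_norm_sub (S h (z t)) (z (t + h)) (z t)]

theorem IsMildSolution.hasDerivWithinAt_iff (hz : IsMildSolution S F x z) (hA : IsGenerator A S)
    (hS : IsContinuousContractionSemigroup S) (hF : Continuous F) {t : ℝ} (ht : 0 ≤ t) {v : H} :
    HasDerivWithinAt z (v + F (z t)) (Ioi t) t ↔ (z t, v) ∈ A.graph := by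
  have hshift := hz.shift hS hF ht
  have hforcing : Tendsto (fun h : ℝ => h⁻¹ • (z (t + h) - S h (z t))) (𝓝[>] 0)
      (𝓝 (F (z t))) := by
    have hlim := hS.tendsto_mildSol_sub (z t) (hF.comp' hshift.continuous)
    simp only [add_zero] at hlim
    refine hlim.congr' ?_
    filter_upwards [self_mem_nhdsWithin] with h hh
    rw [hshift.apply_eq (mem_Ioi.1 hh).le]
  rw [hasDerivWithinAt_Ioi_iff_tendsto, hA]
  constructor <;> intro hlim
  · simpa [← smul_sub] using hlim.sub hforcing
  · simpa [← smul_add] using hlim.add hforcing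

end Regularity

section StrongSolution

variable {H : Type*} [NormedAddCommGroup H] [InnerProductSpace ℝ H]

theorem IsStrongSolution.apply_eq_of_dissipative {D : Submodule ℝ H} {G : D → H} {x : D}
    {z w : ℝ → H} (hz : IsStrongSolution G x z) (hw : IsStrongSolution G x w)
    (hG : ∀ a b : D, inner ℝ (G a - G b) ((a : H) - b) ≤ 0) {t : ℝ} (ht : 0 ≤ t) :
    z t = w t := by
  rcases ht.eq_or_lt with rfl | ht
  · rw [hz.init, hw.init]
  have hac : AbsolutelyContinuousOnInterval (fun s => ‖z s - w s‖ ^ 2) 0 t := by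
    have hnorm := absolutelyContinuousOnInterval_norm
      ((hz.absolutelyContinuous t ht).fun_sub (hw.absolutelyContinuous t ht))
    simpa only [pow_two] using hnorm.fun_mul hnorm
  have hdecrease : ∫ s in (0 : ℝ)..t, deriv (fun s => ‖z s - w s‖ ^ 2) s ≤ 0 := by
    rw [intervalIntegral.integral_of_le ht.le]
    refine setIntegral_nonpos_ae measurableSet_Ioc ?_
    filter_upwards [hz.eqn, hw.eqn] with s hzs hws hs
    have hderiv : HasDerivAt (fun s => ‖z s - w s‖ ^ 2) _ s :=
      ((hzs hs.1).sub (hws hs.1)).norm_sq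
    rw [hderiv.deriv, real_inner_comm]
    exact mul_nonpos_of_nonneg_of_nonpos zero_le_two (hG _ _)
  rw [hac.integral_deriv_eq_sub, hz.init, hw.init, sub_self, norm_zero] at hdecrease
  have hsq : ‖z t - w t‖ ^ 2 = 0 := le_antisymm (by linarith) (sq_nonneg _)
  simpa [sub_eq_zero] using hsq

variable {S : ℝ → H →L[ℝ] H} {A : H →ₗ.[ℝ] H} {F : H → H}

theorem IsGenerator.inner_add_sub_add_nonpos (hA : IsGenerator A S)
    (hS : IsContractionSemigroup S) (hdiss : IsDissipative F) (a b : A.domain) :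
    inner ℝ (A a + F a - (A b + F b)) ((a : H) - b) ≤ 0 := by
  have hlin := hA.inner_nonpos hS (A.mem_graph (a - b))
  rw [A.map_sub] at hlin
  rw [add_sub_add_comm, inner_add_left]
  exact add_nonpos hlin (hdiss a b)

variable [CompleteSpace H] {M : ℝ}

theorem IsMildSolution.isStrongSolution {x : A.domain} {z : ℝ → H}
    (hz : IsMildSolution S F x z) (hA : IsGenerator A S)
    (hS : IsContinuousContractionSemigroup S) (hF : Continuous F) (hdiss : IsDissipative F)
    (hM : ∀ t, 0 ≤ t → ‖F (z t)‖ ≤ M) :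
    IsStrongSolution (fun v : A.domain => A v + F v) x z := by
  choose! g hg hg_le using fun t (ht : 0 ≤ t) =>
    hz.exists_mem_graph hA hS hF hdiss (A.mem_graph x) hM ht
  have hM0 : 0 ≤ M := (norm_nonneg _).trans (hM 0 le_rfl)
  have hlip : LipschitzOnWith (‖A x‖ + M).toNNReal z (Ici 0) := by
    refine LipschitzOnWith.of_dist_le_mul fun s hs t ht => ?_
    rw [Real.coe_toNNReal _ (by positivity)]
    wlog hts : t ≤ s generalizing s t
    · rw [dist_comm, dist_comm s]
      exact this t ht s hs (le_of_not_ge hts)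
    · obtain ⟨h, hh, rfl⟩ := exists_nonneg_add_of_le hts
      rw [dist_eq_norm, Real.dist_eq, add_sub_cancel_left, abs_of_nonneg hh]
      exact hz.norm_sub_le_mul hA hS hF hdiss (A.mem_graph x) hM ht hh
  refine ⟨hz.apply_zero hS.toIsContractionSemigroup, fun T hT => ?_,
    fun t ht => LinearPMap.mem_domain_of_mem_graph (hg t ht), ?_⟩
  · exact (hlip.mono (by rw [uIcc_of_le hT.le]; exact Icc_subset_Ici_self)
      ).absolutelyContinuousOnInterval
  · filter_upwards [ae_hasDerivAt_of_hasDerivWithinAt_Ioi hz.continuous.continuousOn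
      (fun t ht => (hz.hasDerivWithinAt_iff hA hS hF ht).2 (hg t ht))
      (fun t ht => norm_add_le_of_le (hg_le t ht) (hM t ht))] with t hderiv ht
    have hAg : A ⟨z t, LinearPMap.mem_domain_of_mem_graph (hg t ht.le)⟩ = g t :=
      A.mem_graph_snd_inj' (A.mem_graph _) (hg t ht.le) rfl
    simpa only [hAg] using hderiv ht

theorem isStrongFlow_of_isMildSolution {W : ℝ → A.domain → H}
    (hW : ∀ x : A.domain, IsMildSolution S F x fun t => W t x) (hA : IsGenerator A S)
    (hS : IsContinuousContractionSemigroup S) (hF : Continuous F) (hdiss : IsDissipative F)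
    (hbdd : ∀ x, ∃ M, ∀ t, 0 ≤ t → ‖F (W t x)‖ ≤ M) :
    IsStrongFlow (fun v : A.domain => A v + F v) W := by
  intro x
  obtain ⟨M, hM⟩ := hbdd x
  have hstrong := (hW x).isStrongSolution hA hS hF hdiss hM
  exact ⟨hstrong, fun w hw t ht => hw.apply_eq_of_dissipative hstrong
    (hA.inner_add_sub_add_nonpos hS.toIsContractionSemigroup hdiss) ht⟩

end StrongSolution

section BoundedPerturbation

variable {H : Type*} [NormedAddCommGroup H] [InnerProductSpace ℝ H] {S T : ℝ → H →L[ℝ] H}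
  {A : H →ₗ.[ℝ] H} {F : H → H} {G : H →L[ℝ] H} {x y : H} {z w : ℝ → H}

theorem mem_graph_vadd_iff (f : H →ₗ[ℝ] H) :
    (x, y) ∈ (f +ᵥ A).graph ↔ (x, y - f x) ∈ A.graph := by
  simp only [LinearPMap.mem_graph_iff, LinearPMap.vadd_domain]
  refine exists_congr fun v => and_congr_right ?_
  rintro rfl
  exact eq_sub_iff_add_eq'.symm

theorem graphNorm_vadd_le (G : H →L[ℝ] H) (v : A.domain) :
    graphNorm ((G : H →ₗ[ℝ] H) +ᵥ A) v ≤ (1 + ‖G‖) * graphNorm A v := by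
  calc ‖(v : H)‖ + ‖G v + A v‖ ≤ ‖(v : H)‖ + (‖G‖ * ‖(v : H)‖ + ‖A v‖) := by
        gcongr
        exact norm_add_le_of_le (G.le_opNorm v) le_rfl
    _ ≤ (1 + ‖G‖) * (‖(v : H)‖ + ‖A v‖) := by
        linarith [mul_nonneg (norm_nonneg G) (norm_nonneg (A v))]

theorem isMildSolution_zero (hF0 : F 0 = 0) : IsMildSolution S F 0 fun _ => 0 := fun _ =>
  ⟨continuous_const, fun t _ => by simp [mildSol, hF0]⟩

theorem IsMildSolution.const_smul (hz : IsMildSolution S G x z) (c : ℝ) :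
    IsMildSolution S G (c • x) fun t => c • z t := fun a =>
  ⟨hz.continuous.const_smul c, fun t ht => by simp [(hz a).eqOn ht, mildSol]⟩

theorem IsMildSolution.comp_max_zero (hz : IsMildSolution S F x z) :
    IsMildSolution S F x fun t => z (max t 0) := fun a => by
  refine ⟨hz.continuous.comp (by fun_prop), fun t ht => ?_⟩
  rw [max_eq_left ht.1, (hz a).eqOn ht]
  exact mildSol_congr x ht.1 fun s hs => by simp only [max_eq_left hs.1]

theorem IsMildSolution.add (hz : IsMildSolution S G x z) (hw : IsMildSolution S G y w)
    (hS : IsContinuousContractionSemigroup S) : IsMildSolution S G (x + y) fun t => z t + w t :=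
  fun a => by
  refine ⟨hz.continuous.add hw.continuous, fun t ht => ?_⟩
  have hint := fun {v : ℝ → H} (hv : Continuous v) =>
    intervalIntegrable_apply_sub hS.continuous_uncurry (G.continuous.comp' hv) t 0 t
  simp only [(hz a).eqOn ht, (hw a).eqOn ht, mildSol, map_add]
  rw [intervalIntegral.integral_add (hint hz.continuous) (hint hw.continuous), add_add_add_comm]

variable [CompleteSpace H]

theorem IsMildSolution.norm_le (hz : IsMildSolution S F x z)
    (hS : IsContinuousContractionSemigroup S) (hF : Continuous F) (hdiss : IsDissipative F)
    (hF0 : F 0 = 0) {t : ℝ} (ht : 0 ≤ t) : ‖z t‖ ≤ ‖x‖ := by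
  simpa using (hz t).norm_sub_le (isMildSolution_zero hF0 t) hS hF hdiss (right_mem_Icc.2 ht)

theorem IsMildSolution.apply_eq_of_isDissipative (hz : IsMildSolution S F x z)
    (hw : IsMildSolution S F x w) (hS : IsContinuousContractionSemigroup S) (hF : Continuous F)
    (hdiss : IsDissipative F) {t : ℝ} (ht : 0 ≤ t) : z t = w t :=
  (hz t).eqOn_of_isDissipative (hw t) hS hF hdiss (right_mem_Icc.2 ht)

theorem exists_continuousLinearMap_isMildSolution (hS : IsContinuousContractionSemigroup S)
    (hdiss : IsDissipative G) :
    ∃ T : ℝ → H →L[ℝ] H, ∀ x, IsMildSolution S G x fun t => T t x := by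
  choose z hz using exists_isMildSolution hS G.lipschitz.locallyLipschitz hdiss
  have hunique : ∀ {x w}, IsMildSolution S G x w → ∀ t, z x (max t 0) = w (max t 0) :=
    fun hw t => (hz _).apply_eq_of_isDissipative hw hS G.continuous hdiss (le_max_right t 0)
  let T : ℝ → H →L[ℝ] H := fun t => LinearMap.mkContinuous
    { toFun := fun x => z x (max t 0)
      map_add' := fun x y => hunique ((hz x).add (hz y) hS) t
      map_smul' := fun c x => hunique ((hz x).const_smul c) t } 1 fun x => by
    simpa using (hz x).norm_le hS G.continuous hdiss (map_zero G) (le_max_right t 0)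
  exact ⟨T, fun x => (hz x).comp_max_zero⟩

theorem isContractionSemigroup_of_isMildSolution (hT : ∀ x, IsMildSolution S F x fun t => T t x)
    (hS : IsContinuousContractionSemigroup S) (hF : Continuous F) (hdiss : IsDissipative F)
    (hF0 : F 0 = 0) : IsContractionSemigroup T where
  zero := ContinuousLinearMap.ext fun x => (hT x).apply_zero hS.toIsContractionSemigroup
  add s t hs ht := ContinuousLinearMap.ext fun x => by
    rw [add_comm s t]
    exact ((hT x).shift hS hF ht).apply_eq_of_isDissipative (hT (T t x)) hS hF hdiss hs
  continuous_zero x := by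
    have hlim := ((hT x).continuous.tendsto 0).mono_left (nhdsWithin_le_nhds (s := Ioi 0))
    rwa [(hT x).apply_zero hS.toIsContractionSemigroup] at hlim
  contraction _ ht x := (hT x).norm_le hS hF hdiss hF0 ht

theorem isGenerator_vadd_of_isMildSolution (hT : ∀ x, IsMildSolution S G x fun t => T t x)
    (hA : IsGenerator A S) (hS : IsContinuousContractionSemigroup S) :
    IsGenerator ((G : H →ₗ[ℝ] H) +ᵥ A) T := fun x y => by
  have hTx := (hT x).apply_zero hS.toIsContractionSemigroup
  have hiff := (hT x).hasDerivWithinAt_iff hA hS G.continuous le_rfl (v := y - G x)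
  rw [hTx, sub_add_cancel, hasDerivWithinAt_Ioi_iff_tendsto] at hiff
  simp only [zero_add, hTx] at hiff
  exact (mem_graph_vadd_iff _).trans hiff.symm

end BoundedPerturbation

section GraphNorm

variable {H : Type*} [NormedAddCommGroup H] [InnerProductSpace ℝ H] {A : H →ₗ.[ℝ] H}

theorem norm_le_graphNorm (x : A.domain) : ‖(x : H)‖ ≤ graphNorm A x :=
  le_add_of_nonneg_right (norm_nonneg _)

theorem graphNorm_nonneg (x : A.domain) : 0 ≤ graphNorm A x :=
  add_nonneg (norm_nonneg _) (norm_nonneg _)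

theorem IsSemiGloballyPolynomiallyStable.mono {W : ℝ → A.domain → H} {γ γ' : ℝ}
    (hW : IsSemiGloballyPolynomiallyStable A W γ) (hγ' : 0 < γ') (hle : γ' ≤ γ) :
    IsSemiGloballyPolynomiallyStable A W γ' := by
  refine ⟨hγ', fun r hr => ?_⟩
  obtain ⟨C, hC, hdecay⟩ := hW.2 r hr
  refine ⟨C, hC, fun x hx t ht => (hdecay x hx t ht).trans ?_⟩
  have hx0 : 0 ≤ graphNorm A x := graphNorm_nonneg x
  gcongr
  exact le_add_of_nonneg_right ht

end GraphNorm

section Comparison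

theorem norm_sq_le_of_norm_sub_sq_le {E : Type*} [SeminormedAddCommGroup E] {a b : E} {c e : ℝ}
    (hc : 0 ≤ c) (hab : ‖a - b‖ ^ 2 ≤ c * (e - ‖a‖ ^ 2)) :
    ‖a‖ ^ 2 ≤ 2 * c / (1 + 2 * c) * e + 2 * ‖b‖ ^ 2 := by
  have hsplit : ‖a‖ ^ 2 ≤ 2 * (‖a - b‖ ^ 2 + ‖b‖ ^ 2) := by
    have htri : ‖a‖ ≤ ‖a - b‖ + ‖b‖ := norm_le_norm_sub_add a b
    exact (pow_le_pow_left₀ (norm_nonneg a) htri 2).trans add_sq_le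
  have hmul : ‖a‖ ^ 2 * (1 + 2 * c) ≤ 2 * c * e + 2 * ‖b‖ ^ 2 := by linarith
  calc ‖a‖ ^ 2 ≤ (2 * c * e + 2 * ‖b‖ ^ 2) / (1 + 2 * c) := by
        rwa [le_div_iff₀ (by positivity)]
    _ = 2 * c / (1 + 2 * c) * e + 2 * ‖b‖ ^ 2 / (1 + 2 * c) := by ring
    _ ≤ 2 * c / (1 + 2 * c) * e + 2 * ‖b‖ ^ 2 := by
        gcongr
        exact div_le_self (by positivity) (by linarith)

variable {H : Type*} [NormedAddCommGroup H] [InnerProductSpace ℝ H] [CompleteSpace H]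
  {S : ℝ → H →L[ℝ] H} {A : H →ₗ.[ℝ] H} {F : H → H} {x : H} {z w : ℝ → H} {c : ℝ}

theorem IsMildOn.norm_sub_sq_le_of_inner_le {F' : H → H} {a : ℝ} (hz : IsMildOn S F x a z)
    (hw : IsMildOn S F' x a w) (hS : IsContinuousContractionSemigroup S) (hF : Continuous F)
    (hF' : Continuous F') (ha : 0 ≤ a) (hc : 0 ≤ c)
    (hle : ∀ s ∈ Icc 0 a, inner ℝ (F (z s) - F' (w s)) (z s - w s) ≤
      -(c * inner ℝ (F (z s)) (z s))) :
    ‖z a - w a‖ ^ 2 ≤ c * (‖x‖ ^ 2 - ‖z a‖ ^ 2) := by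
  have hzc := hz.continuous
  have hwc := hw.continuous
  have henergy := hS.norm_sq_le_of_eqOn_mildSol x (hF.comp' hzc) hzc ha hz.eqOn
  have hdiff := hS.norm_sq_le_of_eqOn_mildSol 0 (f := fun s => F (z s) - F' (w s))
    (by fun_prop) (u := fun s => z s - w s) (by fun_prop) ha fun s hs => by
      simp only [hz.eqOn hs, hw.eqOn hs,
        mildSol_sub hS.continuous_uncurry x x (hF.comp' hzc) (hF'.comp' hwc), sub_self]
  have hmono : ∫ s in (0 : ℝ)..a, 2 * inner ℝ (F (z s) - F' (w s)) (z s - w s) ≤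
      ∫ s in (0 : ℝ)..a, -c * (2 * inner ℝ (F (z s)) (z s)) := by
    refine intervalIntegral.integral_mono_on ha (Continuous.intervalIntegrable (by fun_prop) _ _)
      (Continuous.intervalIntegrable (by fun_prop) _ _) fun s hs => ?_
    linarith [hle s hs]
  rw [norm_zero, zero_pow two_ne_zero, zero_add] at hdiff
  calc ‖z a - w a‖ ^ 2 ≤ ∫ s in (0 : ℝ)..a, -c * (2 * inner ℝ (F (z s)) (z s)) :=
        hdiff.trans hmono
    _ = c * -∫ s in (0 : ℝ)..a, 2 * inner ℝ (F (z s)) (z s) := by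
        rw [intervalIntegral.integral_const_mul, neg_mul_comm]
    _ ≤ c * (‖x‖ ^ 2 - ‖z a‖ ^ 2) := by
        gcongr
        linarith

theorem IsMildSolution.norm_sq_add_le {F' : H → H} {t τ : ℝ} (hz : IsMildSolution S F x z)
    (hw : IsMildSolution S F' (z t) w) (hS : IsContinuousContractionSemigroup S)
    (hF : Continuous F) (hF' : Continuous F') (hc : 0 ≤ c)
    (hle : ∀ s b, 0 ≤ s → inner ℝ (F (z s) - F' b) (z s - b) ≤ -(c * inner ℝ (F (z s)) (z s)))
    (ht : 0 ≤ t) (hτ : 0 ≤ τ) :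
    ‖z (t + τ)‖ ^ 2 ≤ 2 * c / (1 + 2 * c) * ‖z t‖ ^ 2 + 2 * ‖w τ‖ ^ 2 :=
  norm_sq_le_of_norm_sub_sq_le hc <| ((hz.shift hS hF ht) τ).norm_sub_sq_le_of_inner_le (hw τ)
    hS hF hF' hτ hc fun s hs => hle (t + s) (w s) (add_nonneg ht hs.1)

theorem IsMildSolution.exists_graphNorm_le {x : A.domain} (hz : IsMildSolution S F x z)
    (hA : IsGenerator A S) (hS : IsContinuousContractionSemigroup S) (hF : Continuous F)
    (hdiss : IsDissipative F) (hF0 : F 0 = 0) {L : ℝ} (hL : 0 ≤ L)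
    (hFL : ∀ t, 0 ≤ t → ‖F (z t)‖ ≤ L * ‖z t‖) {t : ℝ} (ht : 0 ≤ t) :
    ∃ p : A.domain, (p : H) = z t ∧ graphNorm A p ≤ (1 + 2 * L) * graphNorm A x := by
  have hzx : ∀ s, 0 ≤ s → ‖z s‖ ≤ ‖(x : H)‖ := fun s hs => hz.norm_le hS hF hdiss hF0 hs
  obtain ⟨v, hv, hv_le⟩ := hz.exists_mem_graph hA hS hF hdiss (A.mem_graph x)
    (fun s hs => (hFL s hs).trans (mul_le_mul_of_nonneg_left (hzx s hs) hL)) ht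
  obtain ⟨p, hp, rfl⟩ := (LinearPMap.mem_graph_iff _).1 hv
  refine ⟨p, hp, ?_⟩
  calc ‖(p : H)‖ + ‖A p‖ ≤ ‖(x : H)‖ + (‖A x‖ + 2 * (L * ‖(x : H)‖)) :=
        add_le_add (hp ▸ hzx t ht) hv_le
    _ ≤ (1 + 2 * L) * (‖(x : H)‖ + ‖A x‖) := by
        linarith [mul_nonneg hL (norm_nonneg (A x))]

theorem IsMildSolution.norm_sq_add_le_of_decay {F' : H → H} {γ C L : ℝ} {x : A.domain}
    (hz : IsMildSolution S F x z) (hA : IsGenerator A S) (hS : IsContinuousContractionSemigroup S)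
    (hF : Continuous F) (hF' : Continuous F') (hdiss : IsDissipative F) (hF0 : F 0 = 0)
    (hc : 0 ≤ c) (hC : 0 ≤ C) (hL : 0 ≤ L) (hFL : ∀ t, 0 ≤ t → ‖F (z t)‖ ≤ L * ‖z t‖)
    (hle : ∀ t b, 0 ≤ t → inner ℝ (F (z t) - F' b) (z t - b) ≤ -(c * inner ℝ (F (z t)) (z t)))
    (hdecay : ∀ p : A.domain, ∃ w, IsMildSolution S F' p w ∧
      ∀ t, 0 ≤ t → ‖w t‖ ≤ C / (1 + t) ^ γ * graphNorm A p)
    {t τ : ℝ} (ht : 0 ≤ t) (hτ : 0 ≤ τ) :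
    ‖z (t + τ)‖ ^ 2 ≤ 2 * c / (1 + 2 * c) * ‖z t‖ ^ 2 +
      2 * (C * (1 + 2 * L) * graphNorm A x) ^ 2 / (1 + τ) ^ (2 * γ) := by
  obtain ⟨p, hp, hpx⟩ := hz.exists_graphNorm_le hA hS hF hdiss hF0 hL hFL ht
  obtain ⟨w, hw, hw_le⟩ := hdecay p
  refine (hz.norm_sq_add_le (hp ▸ hw) hS hF hF' hc hle ht hτ).trans ?_
  gcongr
  calc 2 * ‖w τ‖ ^ 2 ≤ 2 * (C / (1 + τ) ^ γ * ((1 + 2 * L) * graphNorm A x)) ^ 2 := by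
        gcongr
        exact (hw_le τ hτ).trans (by gcongr)
    _ = 2 * (C * (1 + 2 * L) * graphNorm A x) ^ 2 / (1 + τ) ^ (2 * γ) := by
        rw [mul_comm 2 γ, Real.rpow_mul (by positivity), Real.rpow_two]
        ring

variable {G : H →L[ℝ] H} {γ : ℝ}

theorem IsPolynomiallyStable.exists_isMildSolution_norm_le
    (hstab : IsPolynomiallyStable ((G : H →ₗ[ℝ] H) +ᵥ A) γ) (hA : IsGenerator A S)
    (hS : IsContinuousContractionSemigroup S) (hG : IsDissipative G) :
    ∃ C, 0 < C ∧ ∀ p : A.domain, ∃ w, IsMildSolution S G p w ∧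
      ∀ t, 0 ≤ t → ‖w t‖ ≤ C / (1 + t) ^ γ * graphNorm A p := by
  obtain ⟨-, C, hC, hdecay⟩ := hstab
  obtain ⟨T, hT⟩ := exists_continuousLinearMap_isMildSolution hS hG
  have hsemi := isContractionSemigroup_of_isMildSolution hT hS G.continuous hG (map_zero G)
  refine ⟨C * (1 + ‖G‖), by positivity, fun p => ⟨_, hT p, fun t ht => ?_⟩⟩
  calc ‖T t p‖ ≤ C / (1 + t) ^ γ * graphNorm ((G : H →ₗ[ℝ] H) +ᵥ A) p :=
        hdecay T hsemi (isGenerator_vadd_of_isMildSolution hT hA hS) p t ht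
    _ ≤ C / (1 + t) ^ γ * ((1 + ‖G‖) * graphNorm A p) := by
        gcongr
        exact graphNorm_vadd_le G p
    _ = C * (1 + ‖G‖) / (1 + t) ^ γ * graphNorm A p := by ring

theorem IsPolynomiallyStable.exists_norm_le_of_inner_le
    (hstab : IsPolynomiallyStable ((G : H →ₗ[ℝ] H) +ᵥ A) γ) (hA : IsGenerator A S)
    (hS : IsContinuousContractionSemigroup S) (hG : IsDissipative G) (hF : Continuous F)
    (hdiss : IsDissipative F) (hF0 : F 0 = 0) {L : ℝ} (hc : 0 ≤ c) (hL : 0 ≤ L) :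
    ∃ C, 0 < C ∧ ∀ (x : A.domain) (z : ℝ → H), IsMildSolution S F x z →
      (∀ t, 0 ≤ t → ‖F (z t)‖ ≤ L * ‖z t‖) →
      (∀ t b, 0 ≤ t → inner ℝ (F (z t) - G b) (z t - b) ≤ -(c * inner ℝ (F (z t)) (z t))) →
      ∀ t, 0 ≤ t → ‖z t‖ ≤ C / (1 + t) ^ γ * graphNorm A x := by
  obtain ⟨C, hC, hlin⟩ := hstab.exists_isMildSolution_norm_le hA hS hG
  have hq : 2 * c / (1 + 2 * c) < 1 := (div_lt_one (by positivity)).2 (by linarith)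
  obtain ⟨K, hK, hdecay⟩ := exists_forall_le_mul_div_rpow (by positivity) hq
    (mul_pos two_pos hstab.1)
  set D := 1 + 2 * (C * (1 + 2 * L)) ^ 2
  refine ⟨√(K * D), by positivity, fun x z hz hFL hle t ht => ?_⟩
  set N := graphNorm A x
  have hDN : D * N ^ 2 = N ^ 2 + 2 * (C * (1 + 2 * L) * N) ^ 2 := by ring
  have hN0 : 0 ≤ N := graphNorm_nonneg x
  have hbdd : ∀ t, 0 ≤ t → ‖z t‖ ^ 2 ≤ D * N ^ 2 := fun t ht => by
    have hzN : ‖z t‖ ≤ N :=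
      (hz.norm_le hS hF hdiss hF0 ht).trans (norm_le_graphNorm x)
    rw [hDN]
    exact le_add_of_le_of_nonneg (pow_le_pow_left₀ (norm_nonneg _) hzN 2) (by positivity)
  have hstep : ∀ t τ, 0 ≤ t → 0 ≤ τ → ‖z (t + τ)‖ ^ 2 ≤
      2 * c / (1 + 2 * c) * ‖z t‖ ^ 2 + D * N ^ 2 / (1 + τ) ^ (2 * γ) := fun t τ ht hτ => by
    refine (hz.norm_sq_add_le_of_decay hA hS hF G.continuous hdiss hF0 hc hC.le hL hFL hle hlin
      ht hτ).trans (add_le_add_right ?_ _)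
    rw [hDN]
    exact div_le_div_of_nonneg_right (le_add_of_nonneg_left (sq_nonneg N)) (by positivity)
  have hsq := hdecay (fun t => ‖z t‖ ^ 2) (D * N ^ 2) (by positivity) hbdd hstep t ht
  refine le_of_sq_le_sq (hsq.trans_eq ?_) (by positivity)
  rw [mul_pow, div_pow, Real.sq_sqrt (by positivity), mul_comm 2 γ, Real.rpow_mul (by positivity),
    Real.rpow_two]
  ring

end Comparison

section Damping

variable {U : Type*} [NormedAddCommGroup U] [InnerProductSpace ℝ U] {σ : U → U}

namespace IsNonlinearDamping

theorem map_zero (hσ : IsNonlinearDamping σ) : σ 0 = 0 := by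
  obtain ⟨C₁, C₂, -, -, h, -, -, -, -, hle⟩ := hσ.linear_bound
  simpa using hle 0

theorem inner_nonneg (hσ : IsNonlinearDamping σ) (s : U) : 0 ≤ inner ℝ (σ s) s := by
  simpa only [hσ.map_zero, sub_zero] using hσ.monotone s 0

theorem exists_norm_sq_le (hσ : IsNonlinearDamping σ) (R : ℝ) :
    ∃ K, 0 ≤ K ∧ ∀ s, ‖s‖ ≤ R → ‖s‖ ^ 2 ≤ K * inner ℝ (σ s) s := by
  obtain ⟨C₁, C₂, hC₁, hC₂, h, -, hmono, hnonneg, -, hle⟩ := hσ.linear_bound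
  have hhR := hnonneg R
  refine ⟨(1 + C₂ * h R * |R|) / C₁, by positivity, fun s hs => ?_⟩
  have hp := hσ.inner_nonneg s
  have hdev : ‖C₁ • s - σ s‖ ≤ C₂ * h R * inner ℝ (σ s) s := by
    rw [norm_sub_rev]
    exact (hle s).trans (by gcongr; exact hmono hs)
  rw [div_mul_eq_mul_div, le_div_iff₀ hC₁]
  calc ‖s‖ ^ 2 * C₁ = inner ℝ (σ s) s + inner ℝ (C₁ • s - σ s) s := by
        rw [← inner_add_left, add_sub_cancel, real_inner_smul_left, real_inner_self_eq_norm_sq,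
          mul_comm]
    _ ≤ inner ℝ (σ s) s + C₂ * h R * inner ℝ (σ s) s * |R| := by
        gcongr
        exact (real_inner_le_norm _ _).trans (by gcongr; exact hs.trans (le_abs_self R))
    _ = (1 + C₂ * h R * |R|) * inner ℝ (σ s) s := by ring

theorem exists_norm_sub_sq_le (hσ : IsNonlinearDamping σ) (R : ℝ) :
    ∃ c, 0 ≤ c ∧ ∀ s, ‖s‖ ≤ R → ‖s - σ s‖ ^ 2 ≤ c * inner ℝ (σ s) s := by
  obtain ⟨L, hL, hσL⟩ := exists_norm_le_mul_of_locallyLipschitz hσ.locallyLipschitz hσ.map_zero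
    (hσ.bounded (Metric.closedBall 0 R) Metric.isBounded_closedBall)
  obtain ⟨K, hK, hσK⟩ := hσ.exists_norm_sq_le R
  refine ⟨(1 + L) ^ 2 * K, by positivity, fun s hs => ?_⟩
  calc ‖s - σ s‖ ^ 2 ≤ (‖s‖ + L * ‖s‖) ^ 2 := by
        gcongr
        exact norm_sub_le_of_le le_rfl (hσL s hs)
    _ = (1 + L) ^ 2 * ‖s‖ ^ 2 := by ring
    _ ≤ (1 + L) ^ 2 * (K * inner ℝ (σ s) s) := by gcongr; exact hσK s hs
    _ = (1 + L) ^ 2 * K * inner ℝ (σ s) s := by ring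

end IsNonlinearDamping

variable {H : Type*} [NormedAddCommGroup H] [InnerProductSpace ℝ H] [CompleteSpace H]
  [CompleteSpace U] {Q : H →L[ℝ] U}

/-- The nonlinear feedback `z ↦ -Q⋆ σ(Q z)`, to be used with `Q = √k B⋆`. -/
def feedback (Q : H →L[ℝ] U) (σ : U → U) (z : H) : H :=
  -ContinuousLinearMap.adjoint Q (σ (Q z))

/-- The linear feedback `-Q⋆ Q`; with `Q = √k B⋆` it is `-k B B⋆`. -/
def linearFeedback (Q : H →L[ℝ] U) : H →L[ℝ] H :=
  -(ContinuousLinearMap.adjoint Q ∘L Q)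

theorem coe_linearFeedback (Q : H →L[ℝ] U) : ⇑(linearFeedback Q) = feedback Q id := rfl

theorem inner_feedback (z w : H) : inner ℝ (feedback Q σ z) w = -inner ℝ (σ (Q z)) (Q w) := by
  rw [feedback, inner_neg_left, ContinuousLinearMap.adjoint_inner_left]

theorem feedback_zero (h0 : σ 0 = 0) : feedback Q σ 0 = 0 := by
  simp [feedback, h0]

theorem locallyLipschitz_feedback (hσ : LocallyLipschitz σ) : LocallyLipschitz (feedback Q σ) :=
  (-ContinuousLinearMap.adjoint Q).lipschitz.locallyLipschitz.comp
    (hσ.comp Q.lipschitz.locallyLipschitz)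

theorem isDissipative_feedback (hσ : ∀ s₁ s₂ : U, 0 ≤ inner ℝ (σ s₁ - σ s₂) (s₁ - s₂)) :
    IsDissipative (feedback Q σ) := fun a b => by
  rw [inner_sub_left, inner_feedback, inner_feedback, neg_sub_neg, ← neg_sub, ← inner_sub_left,
    map_sub, neg_nonpos]
  exact hσ (Q a) (Q b)

theorem isDissipative_linearFeedback : IsDissipative (linearFeedback Q) := by
  rw [coe_linearFeedback]
  exact isDissipative_feedback fun s₁ s₂ => real_inner_self_nonneg (x := s₁ - s₂)

theorem inner_feedback_sub_linearFeedback_le {a : H} {c : ℝ}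
    (ha : ‖Q a - σ (Q a)‖ ^ 2 ≤ c * inner ℝ (σ (Q a)) (Q a)) (b : H) :
    inner ℝ (feedback Q σ a - linearFeedback Q b) (a - b) ≤
      -(c / 4 * inner ℝ (feedback Q σ a) a) := by
  have hexpand : inner ℝ (feedback Q σ a - linearFeedback Q b) (a - b) =
      inner ℝ (Q a - σ (Q a)) (Q (a - b)) - ‖Q (a - b)‖ ^ 2 := by
    rw [coe_linearFeedback, inner_sub_left, inner_feedback, inner_feedback, id,
      ← real_inner_self_eq_norm_sq, ← inner_sub_left, neg_sub_neg, ← inner_sub_left]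
    congr 1
    rw [map_sub]
    abel
  rw [hexpand, inner_feedback]
  linarith [real_inner_le_norm (Q a - σ (Q a)) (Q (a - b)),
    sq_nonneg (‖Q a - σ (Q a)‖ - 2 * ‖Q (a - b)‖)]

theorem IsNonlinearDamping.exists_norm_feedback_le (hσ : IsNonlinearDamping σ) (Q : H →L[ℝ] U)
    (R : ℝ) : ∃ L, 0 ≤ L ∧ ∀ z, ‖z‖ ≤ R → ‖feedback Q σ z‖ ≤ L * ‖z‖ := by
  refine exists_norm_le_mul_of_locallyLipschitz (locallyLipschitz_feedback hσ.locallyLipschitz)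
    (feedback_zero hσ.map_zero) ?_
  have hbdd : Bornology.IsBounded (σ '' (Q '' Metric.closedBall 0 R)) :=
    hσ.bounded _ (Q.lipschitz.isBounded_image Metric.isBounded_closedBall)
  have himage := (-ContinuousLinearMap.adjoint Q).lipschitz.isBounded_image hbdd
  rwa [image_image, image_image] at himage

variable {A : H →ₗ.[ℝ] H} {S : ℝ → H →L[ℝ] H} {γ : ℝ}

theorem IsNonlinearDamping.exists_norm_le_div_rpow (hσ : IsNonlinearDamping σ)
    (hA : IsGenerator A S) (hS : IsContinuousContractionSemigroup S)
    (hstab : IsPolynomiallyStable ((linearFeedback Q : H →ₗ[ℝ] H) +ᵥ A) γ) (r : ℝ) :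
    ∃ C, 0 < C ∧ ∀ x : A.domain, graphNorm A x ≤ r → ∀ z,
      IsMildSolution S (feedback Q σ) x z →
        ∀ t, 0 ≤ t → ‖z t‖ ≤ C / (1 + t) ^ γ * graphNorm A x := by
  have hF := (locallyLipschitz_feedback (Q := Q) hσ.locallyLipschitz).continuous
  have hdiss := isDissipative_feedback (Q := Q) hσ.monotone
  have hF0 := feedback_zero (Q := Q) hσ.map_zero
  obtain ⟨L, hL, hFL⟩ := hσ.exists_norm_feedback_le Q r
  obtain ⟨c, hc, hdev⟩ := hσ.exists_norm_sub_sq_le (‖Q‖ * r)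
  obtain ⟨C, hC, hdecay⟩ := hstab.exists_norm_le_of_inner_le hA hS isDissipative_linearFeedback
    hF hdiss hF0 (div_nonneg hc zero_le_four) hL
  refine ⟨C, hC, fun x hx z hz => ?_⟩
  have hzr : ∀ t, 0 ≤ t → ‖z t‖ ≤ r := fun t ht =>
    (hz.norm_le hS hF hdiss hF0 ht).trans ((norm_le_graphNorm x).trans hx)
  exact hdecay x z hz (fun t ht => hFL _ (hzr t ht)) fun t b ht =>
    inner_feedback_sub_linearFeedback_le (hdev _ (Q.le_opNorm_of_le (hzr t ht))) b

theorem IsNonlinearDamping.isStrongFlow {W : ℝ → A.domain → H} (hσ : IsNonlinearDamping σ)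
    (hA : IsGenerator A S) (hS : IsContinuousContractionSemigroup S)
    (hW : ∀ x : A.domain, IsMildSolution S (feedback Q σ) x fun t => W t x) :
    IsStrongFlow (fun v : A.domain => A v + feedback Q σ v) W := by
  have hF := (locallyLipschitz_feedback (Q := Q) hσ.locallyLipschitz).continuous
  have hdiss := isDissipative_feedback (Q := Q) hσ.monotone
  refine isStrongFlow_of_isMildSolution hW hA hS hF hdiss fun x => ?_
  obtain ⟨L, hL, hFL⟩ := hσ.exists_norm_feedback_le Q ‖(x : H)‖
  refine ⟨L * ‖(x : H)‖, fun t ht => ?_⟩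
  have hle := (hW x).norm_le hS hF hdiss (feedback_zero hσ.map_zero) ht
  exact (hFL _ hle).trans (mul_le_mul_of_nonneg_left hle hL)

end Damping

section ClosedLoop

variable {H U : Type*} [NormedAddCommGroup H] [InnerProductSpace ℝ H] [CompleteSpace H]
  [NormedAddCommGroup U] [InnerProductSpace ℝ U] [CompleteSpace U] {k : ℝ}

theorem linearClosedLoop_eq_vadd (A : H →ₗ.[ℝ] H) (B : U →L[ℝ] H) (hk : 0 ≤ k) :
    linearClosedLoop A B k =
      (linearFeedback (√k • ContinuousLinearMap.adjoint B) : H →ₗ[ℝ] H) +ᵥ A := by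
  refine LinearPMap.ext rfl fun v hv _ => ?_
  have hfeedback : linearFeedback (√k • ContinuousLinearMap.adjoint B) v =
      -(k • B (ContinuousLinearMap.adjoint B v)) := by
    simp [linearFeedback, smul_smul, Real.mul_self_sqrt hk]
  calc A ⟨v, hv⟩ - k • B (ContinuousLinearMap.adjoint B v)
      = linearFeedback (√k • ContinuousLinearMap.adjoint B) v + A ⟨v, hv⟩ := by
        rw [hfeedback, sub_eq_neg_add]
    _ = _ := rfl

theorem nonlinearClosedLoop_eq (A : H →ₗ.[ℝ] H) (B : U →L[ℝ] H) (k : ℝ) (σ : U → U) :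
    nonlinearClosedLoop A B k σ =
      fun v => A v + feedback (√k • ContinuousLinearMap.adjoint B) σ v := by
  funext v
  simp [nonlinearClosedLoop, feedback, sub_eq_add_neg]

end ClosedLoop

end NonlinearDamping

end

theorem mainTheorem2_general {H U : Type*}
    [NormedAddCommGroup H] [InnerProductSpace ℝ H] [CompleteSpace H]
    [NormedAddCommGroup U] [InnerProductSpace ℝ U] [CompleteSpace U]
    (A : H →ₗ.[ℝ] H) (hA : NonlinearDamping.GeneratesContractionSemigroup A)
    (B : U →L[ℝ] H) (k : ℝ) (hk : 0 ≤ k)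
    (σ : U → U) (hσ : NonlinearDamping.IsNonlinearDamping σ)
    (γ : ℝ) (hlin : NonlinearDamping.IsPolynomiallyStable
      (NonlinearDamping.linearClosedLoop A B k) γ) :
    ∃ W : ℝ → A.domain → H,
      NonlinearDamping.IsStrongFlow (NonlinearDamping.nonlinearClosedLoop A B k σ) W ∧
        NonlinearDamping.IsSemiGloballyPolynomiallyStable A W γ := by
  obtain ⟨S, hS, hAS⟩ := hA.exists_continuous
  rw [NonlinearDamping.linearClosedLoop_eq_vadd A B hk] at hlin
  rw [NonlinearDamping.nonlinearClosedLoop_eq]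
  choose z hz using NonlinearDamping.exists_isMildSolution hS
    (NonlinearDamping.locallyLipschitz_feedback hσ.locallyLipschitz)
    (NonlinearDamping.isDissipative_feedback hσ.monotone)
  refine ⟨fun t x => z x t, hσ.isStrongFlow hAS hS fun x => hz x, hlin.1, fun r _ => ?_⟩
  obtain ⟨C, hC, hdecay⟩ := hσ.exists_norm_le_div_rpow hAS hS hlin r
  exact ⟨C, hC, fun x hx => hdecay x hx _ (hz x)⟩

theorem mainTheorem2 {H U : Type*}
    [NormedAddCommGroup H] [InnerProductSpace ℝ H] [CompleteSpace H]
    [NormedAddCommGroup U] [InnerProductSpace ℝ U] [CompleteSpace U]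
    (A : H →ₗ.[ℝ] H) (hA : NonlinearDamping.GeneratesContractionSemigroup A)
    (B : U →L[ℝ] H) (k : ℝ) (hk : 0 < k)
    (σ : U → U) (hσ : NonlinearDamping.IsNonlinearDamping σ)
    (γ : ℝ) (hγ : 1 / 2 < γ)
    (hlin : NonlinearDamping.IsPolynomiallyStable
      (NonlinearDamping.linearClosedLoop A B k) γ) :
    ∃ W : ℝ → A.domain → H,
      NonlinearDamping.IsStrongFlow (NonlinearDamping.nonlinearClosedLoop A B k σ) W ∧
        NonlinearDamping.IsSemiGloballyPolynomiallyStable A W (1 / 2) := by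
  obtain ⟨W, hW, hstab⟩ := mainTheorem2_general A hA B k hk.le σ hσ γ hlin
  exact ⟨W, hW, hstab.mono one_half_pos hγ.le⟩
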